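/- **Setting in a pre-Lie algebra.** Let $L$ be a real left pre-Lie algebra with product $\triangleright$. Let $S(L)$ be its symmetric algebra, with the coproduct $\Delta(u)=u_{(1)}\otimes u_{(2)}$ for which the elements of $L$ are primitive, and counit $\epsilon$. Extend $\triangleright$ to $S(L)$ by $$1\triangleright u=u,\quad u\triangleright 1=\epsilon(u),\quad (xu)\triangleright y=x\triangleright(u\triangleright y)-(x\triangleright u)\triangleright y,\quad u\triangleright(vw)=(u_{(1)}\triangleright v)(u_{(2)}\triangleright w)$$ for $x,y\in L$ and $u,v,w\in S(L)$. Put $u*v=u_{(1)}(u_{(2)}\triangleright v)$. All these operations are extended $h$-bilinearly to $S(L)[[h]]$, and $\exp$, $\exp^*$ denote the exponential series for the symmetric product and for $*$ respectively. Let $s\ge 0$, $A=(a_{ij})\in\mathbb R^{s\times s}$ and $b\in\mathbb R^{1\times s}$. For $f\in L$ the Runge–Kutta method is $$K_i=\exp\Big(\sum_j a_{ij}K_j\Big)\triangleright (hf),\quad K_i\in hL[[h]],\qquad \Psi_{RK}(hf)=\exp\Big(\sum_j b_jK_j\Big)\in S(L)[[h]].$$ The method has *order $p$ in $L$* if for every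 $f\in L$ the stages $K_i$ exist and are unique and $\Psi_{RK}(hf)-\exp^*(hf)=\mathcal O(h^{p+1})$, i.e. the difference lies in $h^{p+1}S(L)[[h]]$. **The Runge–Kutta character.** Let $T$ be the set of non-planar rooted trees, $F$ the set of forests (finite multisets of trees, with unit $\mathbb 1$), and $B^+:F\to T$ the operation of adding a common root; $\bullet=B^+(\mathbb 1)$, and $|\tau|$ is the number of vertices. The tree factorial is $\tau!=|\tau|\,\tau_1!\cdots\tau_k!$ for $\tau=B^+(\tau_1\cdots\tau_k)$. The symmetry factor is given by $\sigma(\mathbb 1)=1$, $\sigma(t_1\cdots t_k)=\sigma(t_1)\cdots\sigma(t_k)\,\mu_1!\mu_2!\cdots$ (with $\mu_1,\mu_2,\dots$ the multiplicities of the different trees among $t_1,\dots,t_k$) and $\sigma(B^+(\omega))=\sigma(\omega)$. A B-series is an infinite real linear combination of forests, paired with forests by $\langle\omega,\omega'\rangle=\sigma(\omega)\delta_{\omega,\omega'}$. An infinitesimal character is a B-series $\alpha$ with $\langle\alpha,\mathbb 1\rangle=0$ and $\langle\alpha,\omega\omega'\rangle=0$ for all $\omega,\omega'\ne\mathbb 1$.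 With $\exp$ the exponential series for the symmetric product of forests, and $\alpha\triangleright\bullet$ defined linearly by $\omega\triangleright\bullet=B^+(\omega)$, the Runge–Kutta method applied to $\bullet$ is $$K_i=\exp\Big(\sum_j a_{ij}K_j\Big)\triangleright\bullet,\qquad \Psi_{RK}(\bullet)=\exp\Big(\sum_j b_jK_j\Big),$$ with $K_1,\dots,K_s$ infinitesimal characters; put $\langle\mathbf K,\tau\rangle_s=(\langle K_1,\tau\rangle,\dots,\langle K_s,\tau\rangle)^T\in\mathbb R^s$. **Theorem.** Let $s\ge 0$, $A\in\mathbb R^{s\times s}$, $b\in\mathbb R^{1\times s}$. The stages $\mathbf K$ of the method applied to $\bullet$ exist and are unique, and the Runge–Kutta character is given by the recursions $$\langle\Psi_{RK}(\bullet),\tau\rangle=b\,\langle\mathbf K,\tau\rangle_s,\qquad \langle\mathbf K,\bullet\rangle_s=(1,\dots,1)^T,\qquad \langle\mathbf K,B^+(\tau_1\cdots\tau_k)\rangle_s=A\langle\mathbf K,\tau_1\rangle_s\cdots A\langle\mathbf K,\tau_k\rangle_s$$ for all $\tau\in T$, $k\ge1$ and $\tau_1,\dots,\tau_k\in T$, where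 the product of vectors on the right is componentwise. Moreover, for every $p\ge 0$: if $$\langle\Psi_{RK}(\bullet),\tau\rangle=\frac1{\tau!}\quad\text{for all }\tau\in T\text{ with }|\tau|\le p,$$ then the Runge–Kutta method has order $p$ in every real left pre-Lie algebra $L$. -/

import Mathlib

/-! ## The symmetric algebra of a pre-Lie algebra

`L` is a real left pre-Lie algebra, whose product `x ▷ y` is Mathlib's `x * y`.  Its
enveloping algebra (for the zero Lie bracket) is the symmetric algebra `S(L)`, with the
symmetric product and the unshuffle coproduct `Δ` (the elements of `L` are primitive). -/

namespace PreLie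

open scoped TensorProduct
open SymmetricAlgebra

noncomputable section

variable {L : Type*} [LeftPreLieRing L] [LeftPreLieAlgebra ℝ L]

/-- The algebra morphism `S(L) → S(L)[ε]` with `y ↦ y + ε (x ▷ y)` for `y ∈ L`. -/
def derDual (x : L) : SymmetricAlgebra ℝ L →ₐ[ℝ] DualNumber (SymmetricAlgebra ℝ L) :=
  SymmetricAlgebra.lift
    ((TrivSqZeroExt.inlAlgHom ℝ (SymmetricAlgebra ℝ L) (SymmetricAlgebra ℝ L)).toLinearMap ∘ₗ
        ι ℝ L +
      (TrivSqZeroExt.inrHom (SymmetricAlgebra ℝ L) (SymmetricAlgebra ℝ L)).restrictScalars ℝ ∘ₗ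
        ι ℝ L ∘ₗ LinearMap.mulLeft ℝ x)

theorem fst_derDual (x : L) (A : SymmetricAlgebra ℝ L) : (derDual x A).fst = A := by
  have h : (TrivSqZeroExt.fstHom ℝ (SymmetricAlgebra ℝ L) (SymmetricAlgebra ℝ L)).comp
      (derDual x) = AlgHom.id ℝ _ := by
    ext y
    simp [derDual]
  exact congr($h A)

/-- `A ↦ x ▷ A` for `x ∈ L` and `A ∈ S(L)`: the derivation of `S(L)` that extends
`y ↦ x ▷ y`. -/
def der (x : L) : Derivation ℝ (SymmetricAlgebra ℝ L) (SymmetricAlgebra ℝ L) :=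
  Derivation.mk'
    ((TrivSqZeroExt.sndHom (SymmetricAlgebra ℝ L) (SymmetricAlgebra ℝ L)).restrictScalars ℝ ∘ₗ
      (derDual x).toLinearMap)
    (fun A B => by simp [fst_derDual, mul_comm])

theorem der_ι (x y : L) : der x (ι ℝ L y) = ι ℝ L (x * y) := by
  simp [der, derDual]

/-! ### The extension of `▷` to the symmetric algebra: existence and uniqueness -/

theorem prelie {L : Type*} [LeftPreLieRing L] (x y z : L) : x * (y * z) - (x * y) * z = y * (x * z) - (y * x) * z := by
  have := LeftPreLieRing.assoc_symm x y z
  simp only [associator] at this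
  rw [← neg_sub, this, neg_sub]

theorem exists_degreeOne (V : Type*) [AddCommGroup V] [Module ℝ V] :
    ∃ π : SymmetricAlgebra ℝ V →ₗ[ℝ] V, π 1 = 0 ∧
      ∀ x A, π (ι ℝ V x * A) = (Coalgebra.counit (R := ℝ) A) • x := by
  let _ : Module ℝᵐᵒᵖ V := Module.compHom V ((RingHom.id ℝ).fromOpposite mul_comm)
  have _ : IsCentralScalar ℝ V := ⟨fun _ _ => rfl⟩
  let φ : SymmetricAlgebra ℝ V →ₐ[ℝ] TrivSqZeroExt ℝ V :=
    SymmetricAlgebra.lift (TrivSqZeroExt.inrHom ℝ V)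
  have hfst : ∀ A, (φ A).fst = Coalgebra.counit (R := ℝ) A := by
    have h : (TrivSqZeroExt.fstHom ℝ ℝ V).comp φ =
        Bialgebra.counitAlgHom ℝ (SymmetricAlgebra ℝ V) := by
      ext y
      simp [φ, algebraMapInv_ι]
    intro A
    exact congr($h A)
  refine ⟨TrivSqZeroExt.sndHom ℝ V ∘ₗ φ.toLinearMap, by simp, fun x A => ?_⟩
  have : φ (ι ℝ V x) = TrivSqZeroExt.inr x := by simp [φ]
  simp [this, hfst]

theorem exists_split (V : Type*) [AddCommGroup V] [Module ℝ V] :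
    ∃ D : SymmetricAlgebra ℝ V →ₗ[ℝ] V ⊗[ℝ] SymmetricAlgebra ℝ V, D 1 = 0 ∧
      ∀ x A, D (ι ℝ V x * A) =
        x ⊗ₜ A + LinearMap.lTensor V (LinearMap.mulLeft ℝ (ι ℝ V x)) (D A) := by
  obtain ⟨π, h1, hπ⟩ := exists_degreeOne V
  refine ⟨LinearMap.rTensor _ π ∘ₗ Coalgebra.comul, ?_, fun x A => ?_⟩
  · simp [Bialgebra.comul_one, Algebra.TensorProduct.one_def, h1]
  · have key : ∀ z : SymmetricAlgebra ℝ V ⊗[ℝ] SymmetricAlgebra ℝ V,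
        LinearMap.rTensor _ π ((ι ℝ V x ⊗ₜ 1 + 1 ⊗ₜ ι ℝ V x) * z) =
          x ⊗ₜ (TensorProduct.lid ℝ _ (LinearMap.rTensor _ Coalgebra.counit z)) +
          LinearMap.lTensor V (LinearMap.mulLeft ℝ (ι ℝ V x)) (LinearMap.rTensor _ π z) := by
      intro z
      induction z using TensorProduct.induction_on with
      | zero => simp
      | tmul a b => simp [add_mul, hπ, TensorProduct.smul_tmul]
      | add a b ha hb =>
        simp only [mul_add, map_add, ha, hb, TensorProduct.tmul_add]
        abel
    simp [Bialgebra.comul_mul, key, Coalgebra.rTensor_counit_comul]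

/-- Degree-`n` projections. -/
theorem exists_proj (V : Type*) [AddCommGroup V] [Module ℝ V] :
    ∃ φ : SymmetricAlgebra ℝ V →ₐ[ℝ] Polynomial (SymmetricAlgebra ℝ V),
      ∀ n, ∀ A ∈ (LinearMap.range (ι ℝ V)) ^ n, φ A = Polynomial.monomial n A := by
  refine ⟨SymmetricAlgebra.lift
    ((Polynomial.monomial 1).restrictScalars ℝ ∘ₗ ι ℝ V), fun n => ?_⟩
  induction n with
  | zero =>
    intro A hA
    obtain ⟨r, rfl⟩ : ∃ r, algebraMap ℝ _ r = A := by simpa [Submodule.mem_one] using hA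
    simp [Polynomial.monomial_zero_left, Polynomial.C_eq_algebraMap]
  | succ n ih =>
    intro A hA
    rw [pow_succ] at hA
    induction hA using Submodule.mul_induction_on' with
    | mem_mul_mem a ha b hb =>
      obtain ⟨y, rfl⟩ := hb
      rw [map_mul, ih a ha]
      simp [Polynomial.monomial_mul_monomial]
    | add a _ b _ ha hb => simp [ha, hb]

theorem mem_iSup_pow (V : Type*) [AddCommGroup V] [Module ℝ V] (A : SymmetricAlgebra ℝ V) :
    A ∈ ⨆ n, (LinearMap.range (ι ℝ V)) ^ n := by
  induction A using SymmetricAlgebra.induction with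
  | algebraMap r => exact Submodule.mem_iSup_of_mem 0 (by simp [Submodule.mem_one])
  | ι x => exact Submodule.mem_iSup_of_mem 1 (by simp)
  | add a b ha hb => exact add_mem ha hb
  | mul a b ha hb =>
    induction ha using Submodule.iSup_induction' with
    | zero => simp
    | add a a' _ _ h h' => rw [add_mul]; exact add_mem h h'
    | mem m a ha =>
      induction hb using Submodule.iSup_induction' with
      | zero => simp
      | add a a' _ _ h h' => rw [mul_add]; exact add_mem h h'
      | mem n b hb =>
        exact Submodule.mem_iSup_of_mem (m + n) (by
          rw [pow_add]; exact Submodule.mul_mem_mul ha hb)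

theorem der_mem (x : L) (n : ℕ) (A : SymmetricAlgebra ℝ L)
    (hA : A ∈ (LinearMap.range (ι ℝ L)) ^ n) : der x A ∈ (LinearMap.range (ι ℝ L)) ^ n := by
  induction n generalizing A with
  | zero =>
    obtain ⟨r, rfl⟩ : ∃ r, algebraMap ℝ _ r = A := by simpa [Submodule.mem_one] using hA
    simp
  | succ n ih =>
    rw [pow_succ'] at hA
    induction hA using Submodule.mul_induction_on' with
    | mem_mul_mem a ha b hb =>
      obtain ⟨y, rfl⟩ := ha
      rw [Derivation.leibniz, der_ι, smul_eq_mul, smul_eq_mul, mul_comm b, pow_succ']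
      exact add_mem (Submodule.mul_mem_mul ⟨y, rfl⟩ (ih b hb))
        (Submodule.mul_mem_mul ⟨x * y, rfl⟩ hb)
    | add a _ b _ ha hb => rw [map_add]; exact add_mem ha hb

theorem der_add (x y : L) (A : SymmetricAlgebra ℝ L) : der (x + y) A = der x A + der y A := by
  induction A using SymmetricAlgebra.induction with
  | algebraMap r => simp
  | ι z => simp [der_ι, add_mul]
  | mul a b ha hb => simp only [Derivation.leibniz, ha, hb, smul_add]; abel
  | add a b ha hb => simp only [map_add, ha, hb]; abel

theorem der_smul (r : ℝ) (x : L) (A : SymmetricAlgebra ℝ L) : der (r • x) A = r • der x A := by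
  induction A using SymmetricAlgebra.induction with
  | algebraMap r => simp
  | ι z => simp [der_ι, smul_mul_assoc]
  | mul a b ha hb => simp only [Derivation.leibniz, ha, hb, smul_add, smul_comm r]
  | add a b ha hb => simp only [map_add, ha, hb, smul_add]

theorem der_der (x y : L) (A : SymmetricAlgebra ℝ L) :
    der x (der y A) - der (x * y) A = der y (der x A) - der (y * x) A := by
  induction A using SymmetricAlgebra.induction with
  | algebraMap r => simp
  | ι z => simp only [der_ι, ← map_sub, prelie x y z]
  | mul a b ha hb =>
    simp only [Derivation.leibniz, map_add, smul_eq_mul] at *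
    linear_combination a * hb + b * ha
  | add a b ha hb =>
    simp only [map_add]
    linear_combination ha + hb

/-- One step of the recursion: `x ⊗ A ↦ (y ↦ x ▷ (t A y) - t (x ▷ A) y)`. -/
def actStep (t : SymmetricAlgebra ℝ L →ₗ[ℝ] Module.End ℝ L) :
    L ⊗[ℝ] SymmetricAlgebra ℝ L →ₗ[ℝ] Module.End ℝ L :=
  TensorProduct.lift (LinearMap.mk₂ ℝ
    (fun x A => LinearMap.mulLeft ℝ x ∘ₗ t A - t (der x A))
    (fun x y A => by ext z; simp [add_mul, der_add]; abel)
    (fun r x A => by ext z; simp [smul_mul_assoc, der_smul, smul_sub])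
    (fun x A B => by ext z; simp [mul_add]; abel)
    (fun r x A => by ext z; simp [smul_sub]))

theorem actStep_tmul (t : SymmetricAlgebra ℝ L →ₗ[ℝ] Module.End ℝ L) (x : L)
    (A : SymmetricAlgebra ℝ L) (y : L) :
    actStep t (x ⊗ₜ A) y = x * t A y - t (der x A) y := by
  simp [actStep]

theorem exists_act : ∃ T : SymmetricAlgebra ℝ L →ₗ[ℝ] Module.End ℝ L,
    T 1 = 1 ∧ ∀ x A y, T (ι ℝ L x * A) y = x * T A y - T (der x A) y := by
  obtain ⟨D, hD1, hD⟩ := exists_split L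
  obtain ⟨φ, hφ⟩ := exists_proj L
  let t : ℕ → SymmetricAlgebra ℝ L →ₗ[ℝ] Module.End ℝ L := fun n =>
    Nat.rec (LinearMap.toSpanSingleton ℝ _ 1 ∘ₗ Coalgebra.counit)
      (fun n s => ((n : ℝ) + 1)⁻¹ • (actStep s ∘ₗ D)) n
  have ht0 : t 0 1 = 1 := by simp [t]
  have ht : ∀ (n : ℕ) A, ((n : ℝ) + 1) • t (n + 1) A = actStep (t n) (D A) := by
    intro n A
    have : ((n : ℝ) + 1) ≠ 0 := by positivity
    change ((n : ℝ) + 1) • (((n : ℝ) + 1)⁻¹ • actStep (t n) (D A)) = _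
    rw [smul_smul, mul_inv_cancel₀ this, one_smul]
  -- the multiplication `L ⊗ S(L) → S(L)` and Euler's identity
  let μ : L ⊗[ℝ] SymmetricAlgebra ℝ L →ₗ[ℝ] SymmetricAlgebra ℝ L :=
    TensorProduct.lift ((LinearMap.mul ℝ _) ∘ₗ ι ℝ L)
  have hμ : ∀ x A, μ (x ⊗ₜ A) = ι ℝ L x * A := fun x A => by simp [μ]
  have hμl : ∀ x z, μ (LinearMap.lTensor L (LinearMap.mulLeft ℝ (ι ℝ L x)) z) =
      ι ℝ L x * μ z := by
    intro x z
    induction z using TensorProduct.induction_on with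
    | zero => simp
    | tmul a b => simp [hμ, mul_left_comm]
    | add a b ha hb => simp only [map_add, ha, hb, mul_add]
  have hEuler : ∀ n : ℕ, ∀ A ∈ (LinearMap.range (ι ℝ L)) ^ n, μ (D A) = (n : ℝ) • A := by
    intro n
    induction n with
    | zero =>
      intro A hA
      obtain ⟨r, rfl⟩ : ∃ r, algebraMap ℝ _ r = A := by simpa [Submodule.mem_one] using hA
      simp [Algebra.algebraMap_eq_smul_one, hD1]
    | succ n ih =>
      intro A hA
      rw [pow_succ'] at hA
      induction hA using Submodule.mul_induction_on' with
      | mem_mul_mem a ha b hb =>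
        obtain ⟨y, rfl⟩ := ha
        rw [hD, map_add, hμ, hμl, ih b hb]
        simp [add_smul, add_comm]
      | add a _ b _ ha hb => simp [ha, hb]
  have hDspan : ∀ n, ∀ A ∈ (LinearMap.range (ι ℝ L)) ^ (n + 1),
      D A ∈ Submodule.span ℝ {z | ∃ a, ∃ B ∈ (LinearMap.range (ι ℝ L)) ^ n, z = a ⊗ₜ[ℝ] B} := by
    intro n
    induction n with
    | zero =>
      intro A hA
      simp only [zero_add, pow_one] at hA
      obtain ⟨y, rfl⟩ := hA
      have := hD y 1
      rw [mul_one, hD1, map_zero, add_zero] at this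
      rw [this]
      exact Submodule.subset_span ⟨y, 1, by simp [Submodule.mem_one], rfl⟩
    | succ n ih =>
      intro A hA
      rw [pow_succ'] at hA
      induction hA using Submodule.mul_induction_on' with
      | mem_mul_mem a ha b hb =>
        obtain ⟨y, rfl⟩ := ha
        rw [hD]
        refine add_mem (Submodule.subset_span ⟨y, b, hb, rfl⟩) ?_
        have h := Submodule.mem_map_of_mem
          (f := LinearMap.lTensor L (LinearMap.mulLeft ℝ (ι ℝ L y))) (ih b hb)
        rw [Submodule.map_span] at h
        refine Submodule.span_mono ?_ h
        rintro _ ⟨_, ⟨a, B, hB, rfl⟩, rfl⟩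
        refine ⟨a, ι ℝ L y * B, ?_, by simp⟩
        rw [pow_succ']
        exact Submodule.mul_mem_mul ⟨y, rfl⟩ hB
      | add a _ b _ ha hb => rw [map_add]; exact add_mem ha hb
  have claim : ∀ n, ∀ A ∈ (LinearMap.range (ι ℝ L)) ^ n, ∀ x y,
      t (n + 1) (ι ℝ L x * A) y = x * t n A y - t n (der x A) y := by
    intro n
    induction n with
    | zero =>
      intro A hA x y
      obtain ⟨r, rfl⟩ : ∃ r, algebraMap ℝ _ r = A := by simpa [Submodule.mem_one] using hA
      have h := congr($(ht 0 (ι ℝ L x * algebraMap ℝ _ r)) y)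
      rw [hD, Algebra.algebraMap_eq_smul_one, map_smul, hD1] at h
      simp only [Nat.cast_zero, zero_add, one_smul, smul_zero, map_zero, add_zero,
        actStep_tmul] at h
      rw [Algebra.algebraMap_eq_smul_one]
      exact h
    | succ m ih =>
      intro A hA x y
      have h := congr($(ht (m + 1) (ι ℝ L x * A)) y)
      rw [hD, map_add, LinearMap.add_apply, actStep_tmul] at h
      have key : ∀ z ∈ Submodule.span ℝ
          {z | ∃ a, ∃ B ∈ (LinearMap.range (ι ℝ L)) ^ m, z = a ⊗ₜ[ℝ] B},
          actStep (t (m + 1)) (LinearMap.lTensor L (LinearMap.mulLeft ℝ (ι ℝ L x)) z) y =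
            x * t (m + 1) (μ z) y - t (m + 1) (der x (μ z)) y := by
        intro z hz
        induction hz using Submodule.span_induction with
        | zero => simp
        | add u v _ _ hu hv =>
          simp only [map_add, LinearMap.add_apply, hu, hv, mul_add]; abel
        | smul r u _ hu =>
          simp only [map_smul, Derivation.map_smul, LinearMap.smul_apply, hu, mul_smul_comm,
            smul_sub]
        | mem u hu =>
          obtain ⟨a, B, hB, rfl⟩ := hu
          rw [LinearMap.lTensor_tmul, actStep_tmul, hμ, LinearMap.mulLeft_apply,
            Derivation.leibniz, Derivation.leibniz, der_ι, der_ι]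
          simp only [smul_eq_mul, mul_comm B, map_add, LinearMap.add_apply]
          rw [ih B hB, ih B hB, ih _ (der_mem a m B hB), ih _ (der_mem x m B hB),
            ih B hB, ih B hB]
          have e1 := prelie a x (t m B y)
          have e2 := congr(t m $(der_der a x B) y)
          simp only [map_sub, LinearMap.sub_apply] at e2
          simp only [mul_sub]
          have e3 := congr($e1 - $e2)
          rw [← sub_eq_zero] at e3 ⊢
          rw [← e3]
          abel
      rw [key _ (hDspan m A hA), hEuler _ A hA] at h
      have hne : ((m : ℝ) + 1 + 1) ≠ 0 := by positivity
      apply smul_right_injective L hne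
      simp only [Nat.cast_add, Nat.cast_one, map_smul, Derivation.map_smul,
        LinearMap.smul_apply, mul_smul_comm] at h ⊢
      rw [h]
      module
  let T : SymmetricAlgebra ℝ L →ₗ[ℝ] Module.End ℝ L :=
    Polynomial.lsum t ∘ₗ φ.toLinearMap
  have hT : ∀ n, ∀ A ∈ (LinearMap.range (ι ℝ L)) ^ n, T A = t n A := by
    intro n A hA
    simp [T, hφ n A hA, Polynomial.lsum, Polynomial.sum_monomial_index]
  refine ⟨T, ?_, fun x A y => ?_⟩
  · rw [hT 0 1 (by simp [Submodule.mem_one]), ht0]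
  · have hA := mem_iSup_pow L A
    induction hA using Submodule.iSup_induction' with
    | zero => simp
    | add a b _ _ ha hb =>
      simp only [mul_add, map_add, LinearMap.add_apply, ha, hb]; abel
    | mem n a ha =>
      rw [hT n a ha, hT n _ (der_mem x n a ha), ← claim n a ha, hT (n + 1)]
      rw [pow_succ']
      exact Submodule.mul_mem_mul ⟨x, rfl⟩ ha

theorem act_unique {T T' : SymmetricAlgebra ℝ L →ₗ[ℝ] Module.End ℝ L}
    (h1 : T 1 = 1) (h : ∀ x A y, T (ι ℝ L x * A) y = x * T A y - T (der x A) y)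
    (h1' : T' 1 = 1) (h' : ∀ x A y, T' (ι ℝ L x * A) y = x * T' A y - T' (der x A) y) :
    T = T' := by
  have key : ∀ n, ∀ A ∈ (LinearMap.range (ι ℝ L)) ^ n, T A = T' A := by
    intro n
    induction n with
    | zero =>
      intro A hA
      obtain ⟨r, rfl⟩ : ∃ r, algebraMap ℝ _ r = A := by simpa [Submodule.mem_one] using hA
      simp [Algebra.algebraMap_eq_smul_one, h1, h1']
    | succ n ih =>
      intro A hA
      rw [pow_succ'] at hA
      induction hA using Submodule.mul_induction_on' with
      | mem_mul_mem a ha b hb =>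
        obtain ⟨y, rfl⟩ := ha
        ext z
        rw [h, h', ih b hb, ih _ (der_mem y n b hb)]
      | add a _ b _ ha hb => rw [map_add, map_add, ha, hb]
  ext1 A
  induction mem_iSup_pow L A using Submodule.iSup_induction' with
  | zero => simp
  | add a b _ _ ha hb => rw [map_add, map_add, ha, hb]
  | mem n a ha => exact key n a ha

/-- The action `A ↦ (y ↦ A ▷ y)` of `S(L)` on `L`: the unique linear map with `1 ▷ y = y` and
`(x A) ▷ y = x ▷ (A ▷ y) - (x ▷ A) ▷ y` for `x, y ∈ L`, `A ∈ S(L)`. -/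
def act : SymmetricAlgebra ℝ L →ₗ[ℝ] Module.End ℝ L := exists_act.choose

theorem act_one (y : L) : act 1 y = y := by
  rw [act, exists_act.choose_spec.1]; rfl

theorem act_ι_mul (x : L) (A : SymmetricAlgebra ℝ L) (y : L) :
    act (ι ℝ L x * A) y = x * act A y - act (der x A) y :=
  exists_act.choose_spec.2 x A y

theorem act_ι (x y : L) : act (ι ℝ L x) y = x * y := by
  have h := act_ι_mul x 1 y
  rwa [mul_one, act_one, Derivation.map_one_eq_zero, map_zero, LinearMap.zero_apply,
    sub_zero] at h

/-- The map `B ↦ (A ↦ A ▷ B)` as the morphism from `S(L)` to the commutative convolution algebra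
`Hom(S(L), S(L))` that extends `y ↦ (A ↦ A ▷ y)`, `y ∈ L`. -/
def graftHom : SymmetricAlgebra ℝ L →ₐ[ℝ]
    WithConv (SymmetricAlgebra ℝ L →ₗ[ℝ] SymmetricAlgebra ℝ L) :=
  SymmetricAlgebra.lift
    { toFun := fun y => WithConv.toConv (ι ℝ L ∘ₗ (act : _ →ₗ[ℝ] Module.End ℝ L).flip y)
      map_add' := fun x y => by ext A; simp
      map_smul' := fun r x => by ext A; simp }

/-- The product `A ▷ B` on `S(L)`, the extension of `x ▷ y` with
`1 ▷ A = A`, `A ▷ 1 = ε(A)`, `(x A) ▷ y = x ▷ (A ▷ y) - (x ▷ A) ▷ y` and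
`A ▷ (B C) = (A₍₁₎ ▷ B) (A₍₂₎ ▷ C)`. -/
def graft (A B : SymmetricAlgebra ℝ L) : SymmetricAlgebra ℝ L := (graftHom B).ofConv A

theorem graft_ι (A : SymmetricAlgebra ℝ L) (y : L) :
    graft A (ι ℝ L y) = ι ℝ L (act A y) := by
  simp [graft, graftHom]

theorem graft_one (A : SymmetricAlgebra ℝ L) :
    graft A 1 = algebraMap ℝ _ (Coalgebra.counit (R := ℝ) A) := by
  rw [graft, map_one]; rfl

theorem graft_mul (A B C : SymmetricAlgebra ℝ L) :
    graft A (B * C) = LinearMap.mul' ℝ _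
      (TensorProduct.map (graftHom B).ofConv (graftHom C).ofConv (Coalgebra.comul A)) := by
  rw [graft, map_mul]; rfl

theorem graft_one_left (C : SymmetricAlgebra ℝ L) : graft 1 C = C := by
  induction C using SymmetricAlgebra.induction with
  | algebraMap r => rw [graft, AlgHom.commutes]; simp [Algebra.algebraMap_eq_smul_one]
  | ι z => rw [graft_ι, act_one]
  | mul a b ha hb =>
    rw [graft_mul]; simpa [Algebra.TensorProduct.one_def, graft] using congr($ha * $hb)
  | add a b ha hb => simpa [graft] using congr($ha + $hb)

theorem graft_ι_left (x : L) (B : SymmetricAlgebra ℝ L) : graft (ι ℝ L x) B = der x B := by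
  induction B using SymmetricAlgebra.induction with
  | algebraMap r => rw [graft, AlgHom.commutes]; simp
  | ι z => rw [graft_ι, act_ι, der_ι]
  | mul a b ha hb =>
    have ha1 := graft_one_left a
    have hb1 := graft_one_left b
    rw [graft_mul]
    simp only [graft] at ha hb ha1 hb1
    simp [ha, hb, ha1, hb1]
    ring
  | add a b ha hb => simpa [graft] using congr($ha + $hb)

/-- The product `A * B = A₍₁₎ (A₍₂₎ ▷ B)` on `S(L)`. -/
def star (A B : SymmetricAlgebra ℝ L) : SymmetricAlgebra ℝ L :=
  LinearMap.mul' ℝ _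
    (TensorProduct.map LinearMap.id (graftHom B).ofConv (Coalgebra.comul A))

theorem star_ι (x : L) (B : SymmetricAlgebra ℝ L) :
    star (ι ℝ L x) B = ι ℝ L x * B + der x B := by
  have h1 : (graftHom B).ofConv 1 = B := graft_one_left B
  have h2 := graft_ι_left x B
  rw [graft] at h2
  simp [star, h1, h2]

/-! ### Formal series in the step size `h` with coefficients in `S(L)` -/

/-- `α ▷ β`, extended `h`-bilinearly. -/
def seriesGraft (α β : PowerSeries (SymmetricAlgebra ℝ L)) :
    PowerSeries (SymmetricAlgebra ℝ L) :=
  PowerSeries.mk fun n => ∑ ij ∈ Finset.HasAntidiagonal.antidiagonal n,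
    graft (PowerSeries.coeff ij.1 α) (PowerSeries.coeff ij.2 β)

/-- `α * β`, extended `h`-bilinearly. -/
def seriesStar (α β : PowerSeries (SymmetricAlgebra ℝ L)) :
    PowerSeries (SymmetricAlgebra ℝ L) :=
  PowerSeries.mk fun n => ∑ ij ∈ Finset.HasAntidiagonal.antidiagonal n,
    star (PowerSeries.coeff ij.1 α) (PowerSeries.coeff ij.2 β)

/-- The powers `α * ⋯ * α`. -/
def starPow (α : PowerSeries (SymmetricAlgebra ℝ L)) : ℕ → PowerSeries (SymmetricAlgebra ℝ L)
  | 0 => 1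
  | k + 1 => seriesStar (starPow α k) α

/-- `exp*(α) = ∑ₖ α^{*k} / k!` for a series `α` without constant term: the powers with `k > n`
do not contribute to the coefficient of `hⁿ`. -/
def expStar (α : PowerSeries (SymmetricAlgebra ℝ L)) : PowerSeries (SymmetricAlgebra ℝ L) :=
  PowerSeries.mk fun n => ∑ k ∈ Finset.range (n + 1),
    ((k.factorial : ℝ)⁻¹) • PowerSeries.coeff n (starPow α k)

/-- `exp(α) = ∑ₖ αᵏ / k!` (powers for the symmetric product) for a series `α` without constant
term. -/
def expSym (α : PowerSeries (SymmetricAlgebra ℝ L)) : PowerSeries (SymmetricAlgebra ℝ L) :=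
  PowerSeries.mk fun n => ∑ k ∈ Finset.range (n + 1),
    ((k.factorial : ℝ)⁻¹) • PowerSeries.coeff n (α ^ k)

/-- The series `h f`. -/
def stepTimes (f : L) : PowerSeries (SymmetricAlgebra ℝ L) :=
  PowerSeries.monomial 1 (ι ℝ L f)

/-- `α ∈ h L[[h]]`. -/
def IsVectorSeries (α : PowerSeries (SymmetricAlgebra ℝ L)) : Prop :=
  PowerSeries.coeff 0 α = 0 ∧ ∀ n, PowerSeries.coeff n α ∈ LinearMap.range (ι ℝ L)

/-- `K₁, …, K_s` are the stages of the Runge–Kutta method with matrix `A`, applied to `h f`: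
`Kᵢ = exp(∑ⱼ aᵢⱼ Kⱼ) ▷ (h f)`. -/
def IsStages {s : ℕ} (A : Matrix (Fin s) (Fin s) ℝ) (f : L)
    (K : Fin s → PowerSeries (SymmetricAlgebra ℝ L)) : Prop :=
  (∀ i, IsVectorSeries (K i)) ∧
    ∀ i, K i = seriesGraft (expSym (∑ j, A i j • K j)) (stepTimes f)

/-- The result `Ψ(h f) = exp(∑ⱼ bⱼ Kⱼ)` of the Runge–Kutta method. -/
def rkResult {s : ℕ} (b : Fin s → ℝ) (K : Fin s → PowerSeries (SymmetricAlgebra ℝ L)) :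
    PowerSeries (SymmetricAlgebra ℝ L) :=
  expSym (∑ j, b j • K j)

variable (L) in
/-- The Runge–Kutta method with coefficients `A`, `b` has order `p` in `L`: for each `f ∈ L` the
stages exist and are unique, and `Ψ(h f) - exp*(h f) = O(h^{p+1})`. -/
def HasOrder {s : ℕ} (A : Matrix (Fin s) (Fin s) ℝ) (b : Fin s → ℝ) (p : ℕ) : Prop :=
  ∀ f : L, ∃ K : Fin s → PowerSeries (SymmetricAlgebra ℝ L),
    IsStages A f K ∧ (∀ K', IsStages A f K' → K' = K) ∧
      (PowerSeries.X : PowerSeries (SymmetricAlgebra ℝ L)) ^ (p + 1) ∣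
        rkResult b K - expStar (stepTimes f)

end

end PreLie

/-! ## Non-planar rooted trees and B-series -/

namespace BSeries

/-- Planar rooted trees: a root with an ordered list of branches. -/
inductive PlanarTree : Type
  | node : List PlanarTree → PlanarTree

/-- Reordering the branches at one vertex. -/
inductive PlanarTree.Reorder : PlanarTree → PlanarTree → Prop
  | root {l l' : List PlanarTree} : l.Perm l' → Reorder (node l) (node l')
  | branch {t t' : PlanarTree} (l r : List PlanarTree) :
      Reorder t t' → Reorder (node (l ++ t :: r)) (node (l ++ t' :: r))

/-- Non-planar rooted trees: planar rooted trees up to the order of the branches. -/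
def Tree : Type := Quot PlanarTree.Reorder

noncomputable section

/-- The number of vertices of a planar tree. -/
def PlanarTree.order : PlanarTree → ℕ
  | node l => 1 + (l.map PlanarTree.order).sum

theorem PlanarTree.order_node (l : List PlanarTree) :
    (node l).order = 1 + (l.map PlanarTree.order).sum := by
  rw [PlanarTree.order]

theorem PlanarTree.Reorder.order_eq {t t' : PlanarTree} (h : PlanarTree.Reorder t t') :
    t.order = t'.order := by
  induction h with
  | root h => rw [order_node, order_node, (h.map _).sum_eq]
  | branch l r _ ih => simp [order_node, ih]

namespace Tree

/-- The number `|τ|` of vertices. -/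
def order : Tree → ℕ := Quot.lift PlanarTree.order fun _ _ h => h.order_eq

/-- The tree represented by a planar tree. -/
def mk (t : PlanarTree) : Tree := Quot.mk _ t

theorem mk_eq_of_reorder {t t' : PlanarTree} (h : t.Reorder t') : mk t = mk t' := Quot.sound h

/-- A planar representative. -/
def out (τ : Tree) : PlanarTree := Quot.out τ

theorem mk_out (τ : Tree) : mk (out τ) = τ := Quot.out_eq τ

theorem order_out (τ : Tree) : (out τ).order = τ.order := by
  conv_rhs => rw [← mk_out τ]
  rfl

/-- `B⁻`: the forest (multiset of trees) that is left when the root is removed. -/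
def Bminus : Tree → Multiset Tree :=
  Quot.lift (fun | .node l => ((l.map mk : List Tree) : Multiset Tree)) (by
    rintro _ _ (⟨h⟩ | ⟨l, r, h⟩)
    · exact Quot.sound (h.map _)
    · simp only [List.map_append, List.map_cons, mk_eq_of_reorder h])

/-- `B⁺`: the tree obtained from a forest by adding a common root. -/
def Bplus (ω : Multiset Tree) : Tree := mk (.node (ω.toList.map out))

/-- The tree with one vertex. -/
def bullet : Tree := Bplus 0

theorem Bminus_mk (l : List PlanarTree) : Bminus (mk (.node l)) = (l.map mk : List Tree) := rfl

theorem Bminus_Bplus (ω : Multiset Tree) : Bminus (Bplus ω) = ω := by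
  rw [Bplus, Bminus_mk, List.map_map]
  simp [Function.comp_def, mk_out]

theorem mk_node_congr (l l' : List PlanarTree) (h : l.map mk = l'.map mk) :
    mk (.node l) = mk (.node l') := by
  suffices H : ∀ pre : List PlanarTree,
      mk (.node (pre ++ l)) = mk (.node (pre ++ l')) from H []
  induction l generalizing l' with
  | nil =>
    obtain rfl : l' = [] := by simpa using h.symm
    intro pre; rfl
  | cons t l ih =>
    obtain _ | ⟨t', l'⟩ := l'
    · simp at h
    · simp only [List.map_cons, List.cons.injEq] at h
      intro pre
      have e : mk (.node (pre ++ t :: l)) = mk (.node (pre ++ t' :: l)) := by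
        let F : Tree → Tree := Quot.lift (fun u => mk (.node (pre ++ u :: l)))
          fun _ _ hu => mk_eq_of_reorder (.branch pre l hu)
        exact congrArg F h.1
      have := ih l' h.2 (pre ++ [t'])
      simp only [List.append_assoc, List.singleton_append] at this
      rw [e, this]

theorem Bplus_Bminus (τ : Tree) : Bplus (Bminus τ) = τ := by
  obtain ⟨⟨l⟩, rfl⟩ := Quot.exists_rep τ
  change Bplus (Bminus (mk (.node l))) = mk (.node l)
  have hperm : ((Bminus (mk (.node l))).toList).Perm (l.map mk) := by
    rw [← Multiset.coe_eq_coe, Multiset.coe_toList]; rfl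
  rw [Bplus, mk_eq_of_reorder (.root (hperm.map _))]
  apply mk_node_congr
  simp [Function.comp_def, mk_out]

theorem order_mk (t : PlanarTree) : (mk t).order = t.order := rfl

theorem order_Bplus (ω : Multiset Tree) : (Bplus ω).order = 1 + (ω.map order).sum := by
  rw [Bplus, order_mk, PlanarTree.order_node, List.map_map]
  conv_rhs => rw [← Multiset.coe_toList ω, Multiset.map_coe, Multiset.sum_coe]
  simp only [Function.comp_def, order_out]

theorem order_lt_of_mem {τ c : Tree} (h : c ∈ Bminus τ) : c.order < τ.order := by
  have h1 := order_Bplus (Bminus τ)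
  rw [Bplus_Bminus] at h1
  have := Multiset.single_le_sum (s := (Bminus τ).map order) (fun _ _ => Nat.zero_le _) c.order
    (Multiset.mem_map_of_mem _ h)
  omega

/-- The tree factorial `τ! = |τ| τ₁! ⋯ τ_p!` for `τ = B⁺(τ₁ ⋯ τ_p)`. -/
def factorial (τ : Tree) : ℕ :=
  τ.order * ((Bminus τ).attach.map fun c => factorial c.1).prod
termination_by τ.order
decreasing_by exact order_lt_of_mem c.2

theorem factorial_Bplus (ω : Multiset Tree) :
    (Bplus ω).factorial = (Bplus ω).order * (ω.map factorial).prod := by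
  rw [factorial, Multiset.attach_map_val' _ factorial, Bminus_Bplus]

open scoped Classical in
/-- The symmetry factor `σ(τ) = σ(t₁ ⋯ t_k) = σ(t₁) ⋯ σ(t_k) μ₁! μ₂! ⋯` for
`τ = B⁺(t₁ ⋯ t_k)`, with `μ₁, μ₂, …` the multiplicities of the different trees among
`t₁, …, t_k`. -/
def symmetry (τ : Tree) : ℕ :=
  ((Bminus τ).attach.map fun c => symmetry c.1).prod *
    ∏ c ∈ (Bminus τ).toFinset, ((Bminus τ).count c).factorial
termination_by τ.order
decreasing_by exact order_lt_of_mem c.2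

end Tree

/-- Forests: commutative words in trees. -/
abbrev Forest : Type := Multiset Tree

open scoped Classical in
/-- The symmetry factor `σ(t₁ ⋯ t_k) = σ(t₁) ⋯ σ(t_k) μ₁! μ₂! ⋯` of a forest. -/
def Forest.symmetry (ω : Forest) : ℕ :=
  (ω.map Tree.symmetry).prod * ∏ c ∈ ω.toFinset, (ω.count c).factorial

theorem symmetry_Bplus (ω : Forest) : (Tree.Bplus ω).symmetry = Forest.symmetry ω := by
  rw [Tree.symmetry, Multiset.attach_map_val' _ Tree.symmetry, Tree.Bminus_Bplus]
  rfl

theorem symmetry_singleton (τ : Tree) : Forest.symmetry {τ} = τ.symmetry := by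
  simp [Forest.symmetry]

/-- B-series: infinite linear combinations of forests, that is, formal power series in
commuting variables indexed by the trees, with the symmetric product of forests. -/
abbrev Series : Type := MvPowerSeries Tree ℝ

open scoped Classical in
/-- The coefficient of the forest `ω` in a series. -/
def coeff (ω : Forest) (α : Series) : ℝ := MvPowerSeries.coeff (Multiset.toFinsupp ω) α

/-- The pairing `⟨α, ω⟩` for which `⟨ω, ω'⟩` is `σ(ω)` if `ω = ω'` and `0` otherwise. -/
def pairing (α : Series) (ω : Forest) : ℝ := (Forest.symmetry ω : ℝ) * coeff ω α

/-- The infinitesimal characters. -/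
def IsInfinitesimalCharacter (α : Series) : Prop :=
  pairing α 0 = 0 ∧ ∀ ω ω' : Forest, ω ≠ 0 → ω' ≠ 0 → pairing α (ω + ω') = 0

/-- `exp(α) = ∑ₖ αᵏ / k!` for a series `α` without constant term: the powers with `k` larger than
the number of trees of a forest do not contribute to its coefficient. -/
def exp (α : Series) : Series := fun d =>
  ∑ k ∈ Finset.range (d.degree + 1),
    ((k.factorial : ℝ)⁻¹) * MvPowerSeries.coeff d (α ^ k)

open scoped Classical in
/-- `α ▷ •`, where `ω ▷ • = B⁺(ω)` for a forest `ω`. -/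
def graftBullet (α : Series) : Series := fun d =>
  if h : ∃ ω : Forest, d = Finsupp.single (Tree.Bplus ω) 1 then coeff h.choose α else 0

theorem coeff_graftBullet (α : Series) (ω : Forest) :
    coeff {Tree.Bplus ω} (graftBullet α) = coeff ω α := by
  classical
  have h : ∃ ω' : Forest, (Finsupp.single (Tree.Bplus ω) 1 : Tree →₀ ℕ) =
      Finsupp.single (Tree.Bplus ω') 1 := ⟨ω, rfl⟩
  have e : h.choose = ω := by
    have := congrArg Tree.Bminus (Finsupp.single_left_injective one_ne_zero h.choose_spec)
    rw [Tree.Bminus_Bplus, Tree.Bminus_Bplus] at this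
    exact this.symm
  rw [coeff, Multiset.toFinsupp_singleton]
  change graftBullet α (Finsupp.single (Tree.Bplus ω) 1) = _
  rw [graftBullet, dif_pos h, e]

/-- `K₁, …, K_s` are the stages of the Runge–Kutta method with matrix `A`, applied to `•`:
`Kᵢ = exp(∑ⱼ aᵢⱼ Kⱼ) ▷ •`. -/
def IsStages {s : ℕ} (A : Matrix (Fin s) (Fin s) ℝ) (K : Fin s → Series) : Prop :=
  (∀ i, IsInfinitesimalCharacter (K i)) ∧ ∀ i, K i = graftBullet (exp (∑ j, A i j • K j))

/-- The Runge–Kutta character `Ψ(•) = exp(∑ⱼ bⱼ Kⱼ)`. -/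
def rkCharacter {s : ℕ} (b : Fin s → ℝ) (K : Fin s → Series) : Series :=
  exp (∑ j, b j • K j)

/-- The vector `⟨K, τ⟩ₛ = (⟨K₁, τ⟩, …, ⟨K_s, τ⟩)`. -/
def stagePairing {s : ℕ} (K : Fin s → Series) (τ : Tree) : Fin s → ℝ :=
  fun i => pairing (K i) {τ}

end

end BSeries

/-!
For the first half, an infinitesimal character is determined by its values on trees, and the
multinomial formula gives `⟨exp α, ω⟩ = ∏ ⟨α, τ⟩`, the product over the trees `τ` of the forest `ω`
(`BSeries.pairing_exp`).  Since the pairing carries the symmetry factors, and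
`σ(B⁺(ω)) = σ(ω)`, the stage equation paired with `B⁺(ω)` is exactly the recursion of the theorem.
It is a recursion on the number of vertices, so it gives existence and uniqueness of the stages.

For the second half, fix `f ∈ L` and let `F` be the elementary differential,
`F(B⁺(τ₁ ⋯ τ_k)) = (F(τ₁) ⋯ F(τ_k)) ▷ f`.  The substitution `τ ↦ h^{|τ|} F(τ)` is a morphism `Φ` of
algebras from B-series to `S(L)[[h]]` (`PreLie.substitute`) that commutes with the exponential and
turns `β ▷ •` into `Φ(β) ▷ (h f)` (`PreLie.substitute_exp`, `PreLie.substitute_graftBullet`).  So it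
maps the stages and the Runge–Kutta character to the stages and the result of the method in `L`.

It remains to see that `exp*(h f) = Φ(exp θ)`, where `θ` is the infinitesimal character
`τ ↦ 1 / τ!`.  Put `W = ∑ₙ hⁿ⁺¹ / (n+1)! ℓⁿ f`, with `ℓ` the left multiplication by `f`.

* Both `exp*(h f)` and `exp W` solve `y' = f y + f ▷ y`, so they are equal
  (`PreLie.expSym_flowLog`).
* Since `(f * u) ▷ f = f ▷ (u ▷ f)`, the coefficients of `exp*(h f)` act on `f` by powers of `ℓ`,
  whence `h W' = exp(W) ▷ (h f)` (`PreLie.coeff_succ_flowLog_eq_act`).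
* The recursion of the tree factorial says that `Φ(θ)` solves the same equation, which has only one
  solution without constant term, so `Φ(θ) = W` (`PreLie.substitute_exactFlow`).

If the Runge–Kutta character takes the values `1 / τ!` on the trees with at most `p` vertices, it
agrees with `exp θ` on the forests with at most `p` vertices, because both are characters.  Hence
their images under `Φ` agree modulo `h^{p+1}`.
-/

namespace BSeries

noncomputable section

/-! ### Symmetry factors and finiteness -/

theorem Tree.symmetry_pos (τ : Tree) : 0 < τ.symmetry := by
  induction h : τ.order using Nat.strong_induction_on generalizing τ with
  | _ n ih =>
    subst h
    rw [← Tree.Bplus_Bminus τ, symmetry_Bplus, Forest.symmetry]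
    refine Nat.mul_pos (Multiset.prod_pos ?_) (Finset.prod_pos fun _ _ => Nat.factorial_pos _)
    intro m hm
    obtain ⟨c, hc, rfl⟩ := Multiset.mem_map.1 hm
    exact ih _ (Tree.order_lt_of_mem hc) c rfl

theorem Forest.symmetry_pos (ω : Forest) : 0 < Forest.symmetry ω := by
  rw [← symmetry_Bplus]
  exact Tree.symmetry_pos _

theorem Tree.order_pos (τ : Tree) : 0 < τ.order := by
  rw [← Tree.Bplus_Bminus τ, Tree.order_Bplus]
  omega

/-- To prove a property of trees, it suffices to derive it for `B⁺(τ₁ ⋯ τ_k)` from its validity for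
`τ₁, …, τ_k`. -/
theorem Tree.induction_Bplus {P : Tree → Prop}
    (h : ∀ ω : Forest, (∀ τ ∈ ω, P τ) → P (Tree.Bplus ω)) (τ : Tree) : P τ := by
  induction hn : τ.order using Nat.strong_induction_on generalizing τ with
  | _ n ih =>
    subst hn
    rw [← Tree.Bplus_Bminus τ]
    exact h _ fun c hc => ih _ (Tree.order_lt_of_mem hc) c rfl

theorem Tree.Bplus_injective : Function.Injective Tree.Bplus :=
  Function.LeftInverse.injective Tree.Bminus_Bplus

/-- The number of vertices of a forest. -/
def Forest.order (ω : Forest) : ℕ := (ω.map Tree.order).sum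

theorem Forest.card_le_order (ω : Forest) : ω.card ≤ Forest.order ω := by
  have := Multiset.card_nsmul_le_sum (s := ω.map Tree.order) (a := 1) (by
    intro m hm
    obtain ⟨c, -, rfl⟩ := Multiset.mem_map.1 hm
    exact c.order_pos)
  rw [Multiset.card_map, nsmul_eq_mul, mul_one] at this
  exact_mod_cast this

theorem Forest.order_le_of_mem {ω : Forest} {τ : Tree} (h : τ ∈ ω) :
    τ.order ≤ Forest.order ω :=
  Multiset.single_le_sum (fun _ _ => Nat.zero_le _) _ (Multiset.mem_map_of_mem _ h)

theorem Tree.finite_order_le (n : ℕ) : {τ : Tree | τ.order ≤ n}.Finite := by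
  classical
  induction n with
  | zero =>
    convert Set.finite_empty
    ext τ
    simp [τ.order_pos.ne']
  | succ n ih =>
    refine ((Set.finite_Iic (n • ih.toFinset.val)).image Tree.Bplus).subset fun τ hτ => ?_
    refine ⟨Tree.Bminus τ, ?_, Tree.Bplus_Bminus τ⟩
    have hτ' : Forest.order (Tree.Bminus τ) ≤ n := by
      rw [Set.mem_ofPred_eq, ← Tree.Bplus_Bminus τ, Tree.order_Bplus] at hτ
      rw [Forest.order]; omega
    -- A forest with at most `n` vertices contains each tree at most `n` times.
    rw [Set.mem_Iic, Multiset.le_iff_count]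
    intro c
    rw [Multiset.count_nsmul]
    by_cases hc : c ∈ Tree.Bminus τ
    · have h1 : c ∈ ih.toFinset.val := by
        simpa using (Forest.order_le_of_mem hc).trans hτ'
      have h2 := Multiset.one_le_count_iff_mem.2 h1
      calc Multiset.count c (Tree.Bminus τ) ≤ (Tree.Bminus τ).card := Multiset.count_le_card _ _
        _ ≤ n := (Forest.card_le_order _).trans hτ'
        _ ≤ _ := Nat.le_mul_of_pos_right _ h2
    · simp [Multiset.count_eq_zero_of_notMem hc]

/-! ### Infinitesimal characters and their exponentials -/

theorem exists_eq_single_of_degree_eq_one {d : Tree →₀ ℕ} (hd : d.degree = 1) :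
    ∃ τ, d = Finsupp.single τ 1 :=
  (Finsupp.sum_eq_one_iff d).1 hd

theorem isInfinitesimalCharacter_iff {α : Series} : IsInfinitesimalCharacter α ↔
    ∀ d : Tree →₀ ℕ, d.degree ≠ 1 → MvPowerSeries.coeff d α = 0 := by
  classical
  have key : ∀ ω : Forest, pairing α ω = 0 ↔
      MvPowerSeries.coeff (Multiset.toFinsupp ω) α = 0 := by
    intro ω
    have : (Forest.symmetry ω : ℝ) ≠ 0 := by exact_mod_cast (Forest.symmetry_pos ω).ne'
    rw [pairing, mul_eq_zero, or_iff_right this, coeff]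
  constructor
  · rintro ⟨h0, h⟩ d hd
    obtain ⟨ω, rfl⟩ := Multiset.toFinsupp.surjective d
    rw [← key]
    obtain rfl | ⟨τ, hτ⟩ := ω.empty_or_exists_mem
    · exact h0
    · obtain ⟨ω, rfl⟩ := Multiset.exists_cons_of_mem hτ
      rw [← Multiset.singleton_add] at hd ⊢
      refine h _ _ (by simp) ?_
      rintro rfl
      simp at hd
  · intro h
    refine ⟨(key 0).2 (h _ (by simp)), fun ω ω' hω hω' => (key _).2 (h _ ?_)⟩
    have e : ∀ η : Forest, η ≠ 0 → (Multiset.toFinsupp η).degree ≠ 0 := by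
      intro η hη
      simpa [Finsupp.degree_eq_zero_iff] using hη
    have := e ω hω
    have := e ω' hω'
    rw [map_add, map_add]
    omega

/-- The multinomial formula for the powers of an infinite linear combination of trees. -/
theorem coeff_pow_of_isInfinitesimalCharacter {α : Series} (h : IsInfinitesimalCharacter α)
    (k : ℕ) (d : Tree →₀ ℕ) : MvPowerSeries.coeff d (α ^ k) = if d.degree = k then
      (k.factorial : ℝ) *
        d.prod fun τ n => MvPowerSeries.coeff (Finsupp.single τ 1) α ^ n / (n.factorial : ℝ)
      else 0 := by
  classical
  rw [isInfinitesimalCharacter_iff] at h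
  induction k generalizing d with
  | zero =>
    rw [pow_zero, MvPowerSeries.coeff_one]
    by_cases hd : d = 0
    · simp [hd]
    · simp [hd, Finsupp.degree_eq_zero_iff]
  | succ k ih =>
    -- Only the splittings of `d` that take one tree into the first factor contribute.
    rw [pow_succ', MvPowerSeries.coeff_mul]
    have e : ∑ p ∈ Finset.HasAntidiagonal.antidiagonal d,
        MvPowerSeries.coeff p.1 α * MvPowerSeries.coeff p.2 (α ^ k) =
        ∑ τ ∈ d.support, MvPowerSeries.coeff (Finsupp.single τ 1) α *
          MvPowerSeries.coeff (d - Finsupp.single τ 1) (α ^ k) := by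
      symm
      refine Finset.sum_of_injOn (fun τ => (Finsupp.single τ 1, d - Finsupp.single τ 1))
        ?_ ?_ ?_ ?_
      · intro τ _ τ' _ hτ
        exact Finsupp.single_left_injective one_ne_zero (Prod.ext_iff.1 hτ).1
      · intro τ hτ
        simp only [Finset.mem_coe, Finset.HasAntidiagonal.mem_antidiagonal]
        refine add_tsub_cancel_of_le ?_
        rw [Finsupp.single_le_iff]
        exact Nat.one_le_iff_ne_zero.2 (Finsupp.mem_support_iff.1 hτ)
      · rintro ⟨i, j⟩ hij hn
        simp only [Finset.HasAntidiagonal.mem_antidiagonal] at hij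
        rw [h i, zero_mul]
        intro hi
        obtain ⟨τ, rfl⟩ := exists_eq_single_of_degree_eq_one hi
        refine hn ⟨τ, ?_, ?_⟩
        · rw [Finset.mem_coe, Finsupp.mem_support_iff, ← hij]
          simp
        · rw [← hij]; simp
      · intro τ _; rfl
    rw [e]
    by_cases hd : d.degree = k + 1
    · rw [if_pos hd]
      have step : ∀ τ ∈ d.support, MvPowerSeries.coeff (Finsupp.single τ 1) α *
          MvPowerSeries.coeff (d - Finsupp.single τ 1) (α ^ k) =
          (d τ : ℝ) * ((k.factorial : ℝ) * d.prod fun τ n =>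
            MvPowerSeries.coeff (Finsupp.single τ 1) α ^ n / (n.factorial : ℝ)) := by
        intro τ hτ
        have hle : Finsupp.single τ 1 ≤ d := by
          rw [Finsupp.single_le_iff]
          exact Nat.one_le_iff_ne_zero.2 (Finsupp.mem_support_iff.1 hτ)
        obtain ⟨d', rfl⟩ := exists_add_of_le hle
        have hdeg : d'.degree = k := by
          rw [map_add, Finsupp.degree_single] at hd; omega
        rw [add_tsub_cancel_left, ih, if_pos hdeg]
        have e1 : ∀ e : Tree →₀ ℕ, (e.prod fun τ n =>
            MvPowerSeries.coeff (Finsupp.single τ 1) α ^ n / (n.factorial : ℝ)) =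
            MvPowerSeries.coeff (Finsupp.single τ 1) α ^ e τ / ((e τ).factorial : ℝ) *
            (e.erase τ).prod fun τ n =>
              MvPowerSeries.coeff (Finsupp.single τ 1) α ^ n / (n.factorial : ℝ) := fun e =>
          (Finsupp.mul_prod_erase' e τ _ (by simp)).symm
        rw [e1 d', e1 (Finsupp.single τ 1 + d'), Finsupp.erase_add, Finsupp.erase_single,
          zero_add]
        simp only [Finsupp.add_apply, Finsupp.single_eq_same]
        rw [add_comm 1, Nat.factorial_succ, pow_succ]
        have := Nat.factorial_ne_zero (d' τ)
        push_cast
        field_simp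
      rw [Finset.sum_congr rfl step, ← Finset.sum_mul, ← Nat.cast_sum]
      rw [show ∑ τ ∈ d.support, d τ = d.degree from rfl, hd, Nat.factorial_succ]
      push_cast
      ring
    · rw [if_neg hd]
      refine Finset.sum_eq_zero fun τ hτ => ?_
      have hle : Finsupp.single τ 1 ≤ d := by
        rw [Finsupp.single_le_iff]
        exact Nat.one_le_iff_ne_zero.2 (Finsupp.mem_support_iff.1 hτ)
      obtain ⟨d', rfl⟩ := exists_add_of_le hle
      rw [map_add, Finsupp.degree_single] at hd
      rw [add_tsub_cancel_left, ih, if_neg (by omega), mul_zero]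

theorem coeff_exp_of_isInfinitesimalCharacter {α : Series} (h : IsInfinitesimalCharacter α)
    (d : Tree →₀ ℕ) : MvPowerSeries.coeff d (exp α) =
      d.prod fun τ n => MvPowerSeries.coeff (Finsupp.single τ 1) α ^ n / (n.factorial : ℝ) := by
  change exp α d = _
  rw [exp, Finset.sum_eq_single d.degree]
  · rw [coeff_pow_of_isInfinitesimalCharacter h, if_pos rfl]
    have : (d.degree.factorial : ℝ) ≠ 0 := by exact_mod_cast Nat.factorial_ne_zero _
    field_simp
  · intro k _ hk
    rw [coeff_pow_of_isInfinitesimalCharacter h, if_neg hk.symm, mul_zero]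
  · simp

open scoped Classical in
theorem pairing_singleton (α : Series) (τ : Tree) :
    pairing α {τ} = (τ.symmetry : ℝ) * MvPowerSeries.coeff (Finsupp.single τ 1) α := by
  rw [pairing, coeff, Multiset.toFinsupp_singleton, symmetry_singleton]

open scoped Classical in
/-- The exponential of an infinitesimal character is a character. -/
theorem pairing_exp {α : Series} (h : IsInfinitesimalCharacter α) (ω : Forest) :
    pairing (exp α) ω = (ω.map fun τ => pairing α {τ}).prod := by
  rw [pairing, coeff, coeff_exp_of_isInfinitesimalCharacter h, Forest.symmetry]
  rw [Finset.prod_multiset_map_count ω fun τ => pairing α {τ}]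
  rw [Finsupp.prod, Multiset.toFinsupp_support,
    Finset.prod_multiset_map_count ω Tree.symmetry]
  push_cast
  rw [← Finset.prod_mul_distrib, ← Finset.prod_mul_distrib]
  refine Finset.prod_congr rfl fun τ _ => ?_
  rw [pairing_singleton, Multiset.toFinsupp_apply, mul_pow]
  have := Nat.factorial_ne_zero (ω.count τ)
  field_simp

theorem pairing_exp_singleton {α : Series} (h : IsInfinitesimalCharacter α) (τ : Tree) :
    pairing (exp α) {τ} = pairing α {τ} := by
  rw [pairing_exp h, Multiset.map_singleton, Multiset.prod_singleton]

theorem pairing_graftBullet (α : Series) (ω : Forest) :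
    pairing (graftBullet α) {Tree.Bplus ω} = pairing α ω := by
  rw [pairing, coeff_graftBullet, symmetry_singleton, symmetry_Bplus, pairing]

theorem isInfinitesimalCharacter_graftBullet (α : Series) :
    IsInfinitesimalCharacter (graftBullet α) := by
  rw [isInfinitesimalCharacter_iff]
  intro d hd
  change graftBullet α d = 0
  rw [graftBullet, dif_neg]
  rintro ⟨ω, rfl⟩
  exact hd (Finsupp.degree_single _ _)

theorem IsInfinitesimalCharacter.ext {α β : Series} (hα : IsInfinitesimalCharacter α)
    (hβ : IsInfinitesimalCharacter β) (h : ∀ τ, pairing α {τ} = pairing β {τ}) : α = β := by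
  rw [isInfinitesimalCharacter_iff] at hα hβ
  ext d
  by_cases hd : d.degree = 1
  · obtain ⟨τ, rfl⟩ := exists_eq_single_of_degree_eq_one hd
    have := h τ
    rw [pairing_singleton, pairing_singleton] at this
    exact mul_left_cancel₀ (by exact_mod_cast τ.symmetry_pos.ne') this
  · rw [hα d hd, hβ d hd]

theorem isInfinitesimalCharacter_sum {s : ℕ} {K : Fin s → Series}
    (hK : ∀ i, IsInfinitesimalCharacter (K i)) (c : Fin s → ℝ) :
    IsInfinitesimalCharacter (∑ j, c j • K j) := by
  simp only [isInfinitesimalCharacter_iff] at hK ⊢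
  intro d hd
  rw [map_sum]
  exact Finset.sum_eq_zero fun j _ => by rw [MvPowerSeries.coeff_smul, hK j d hd, mul_zero]

theorem pairing_sum {s : ℕ} (K : Fin s → Series) (c : Fin s → ℝ) (ω : Forest) :
    pairing (∑ j, c j • K j) ω = ∑ j, c j * pairing (K j) ω := by
  simp only [pairing, coeff, map_sum, MvPowerSeries.coeff_smul, Finset.mul_sum]
  exact Finset.sum_congr rfl fun j _ => by ring

theorem IsInfinitesimalCharacter.coeff_eq_zero {α : Series} (h : IsInfinitesimalCharacter α)
    {ω : Forest} (hω : ω.card ≠ 1) : coeff ω α = 0 := by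
  classical
  refine isInfinitesimalCharacter_iff.1 h _ fun hd => hω ?_
  exact (Multiset.toFinsupp_sum_eq ω).symm.trans hd

theorem coeff_eq_pairing_div (α : Series) (ω : Forest) :
    coeff ω α = pairing α ω / (Forest.symmetry ω : ℝ) := by
  rw [pairing, mul_div_cancel_left₀]
  exact_mod_cast (Forest.symmetry_pos ω).ne'

/-- The infinitesimal character whose pairing with each tree `τ` is `c τ`; the division by the
symmetry factor compensates the one in the pairing. -/
def ofTree (c : Tree → ℝ) : Series := fun d =>
  letI := Classical.decEq (Tree →₀ ℕ)
  ∑ τ ∈ d.support, if d = Finsupp.single τ 1 then c τ / (τ.symmetry : ℝ) else 0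

theorem isInfinitesimalCharacter_ofTree (c : Tree → ℝ) :
    IsInfinitesimalCharacter (ofTree c) := by
  rw [isInfinitesimalCharacter_iff]
  intro d hd
  change ofTree c d = 0
  refine Finset.sum_eq_zero fun τ _ => if_neg ?_
  rintro rfl
  exact hd (Finsupp.degree_single _ _)

theorem pairing_ofTree (c : Tree → ℝ) (τ : Tree) : pairing (ofTree c) {τ} = c τ := by
  rw [pairing_singleton]
  change _ * ofTree c (Finsupp.single τ 1) = _
  rw [ofTree, Finsupp.support_single _ one_ne_zero, Finset.sum_singleton, if_pos rfl,
    mul_div_cancel₀]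
  exact_mod_cast τ.symmetry_pos.ne'

/-! ### The stages of the Runge–Kutta method applied to `•` -/

/-- The stage equation, paired with `B⁺(ω)`. -/
theorem stagePairing_Bplus {s : ℕ} {A : Matrix (Fin s) (Fin s) ℝ} {K : Fin s → Series}
    (h : IsStages A K) (ω : Forest) :
    stagePairing K (Tree.Bplus ω) =
      (ω.map fun τ => A.mulVec (stagePairing K τ)).prod := by
  ext i
  rw [stagePairing, h.2 i, pairing_graftBullet,
    pairing_exp (isInfinitesimalCharacter_sum h.1 _), Pi.multiset_prod_apply, Multiset.map_map]
  congr 1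
  exact Multiset.map_congr rfl fun τ _ => pairing_sum _ _ _

theorem IsStages.unique {s : ℕ} {A : Matrix (Fin s) (Fin s) ℝ} {K K' : Fin s → Series}
    (h : IsStages A K) (h' : IsStages A K') : K' = K := by
  have e : ∀ τ, stagePairing K' τ = stagePairing K τ := by
    refine Tree.induction_Bplus fun ω ih => ?_
    rw [stagePairing_Bplus h, stagePairing_Bplus h']
    congr 1
    exact Multiset.map_congr rfl fun τ hτ => by rw [ih τ hτ]
  funext i
  exact (h'.1 i).ext (h.1 i) fun τ => congrFun (e τ) i

/-- The values of the stages on trees, by recursion on the branches at the root. -/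
def stageValue {s : ℕ} (A : Matrix (Fin s) (Fin s) ℝ) (τ : Tree) : Fin s → ℝ :=
  ((Tree.Bminus τ).attach.map fun c => A.mulVec (stageValue A c.1)).prod
termination_by τ.order
decreasing_by exact Tree.order_lt_of_mem c.2

theorem stageValue_Bplus {s : ℕ} (A : Matrix (Fin s) (Fin s) ℝ) (ω : Forest) :
    stageValue A (Tree.Bplus ω) = (ω.map fun τ => A.mulVec (stageValue A τ)).prod := by
  rw [stageValue, Multiset.attach_map_val' _ fun τ => A.mulVec (stageValue A τ),
    Tree.Bminus_Bplus]

theorem exists_isStages {s : ℕ} (A : Matrix (Fin s) (Fin s) ℝ) :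
    ∃ K : Fin s → Series, IsStages A K := by
  have hc : ∀ i, IsInfinitesimalCharacter (ofTree fun τ => stageValue A τ i) := fun i =>
    isInfinitesimalCharacter_ofTree _
  refine ⟨fun i => ofTree fun τ => stageValue A τ i, hc, fun i => ?_⟩
  refine (hc i).ext (isInfinitesimalCharacter_graftBullet _) fun τ => ?_
  rw [← Tree.Bplus_Bminus τ, pairing_graftBullet,
    pairing_exp (isInfinitesimalCharacter_sum hc _), pairing_ofTree, stageValue_Bplus,
    Pi.multiset_prod_apply, Multiset.map_map]
  congr 1
  refine Multiset.map_congr rfl fun τ _ => ?_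
  simp [pairing_sum, pairing_ofTree, Matrix.mulVec, dotProduct]

end

end BSeries

namespace PreLie

open scoped TensorProduct
open SymmetricAlgebra

noncomputable section

variable {L : Type*} [LeftPreLieRing L] [LeftPreLieAlgebra ℝ L]

/-! ### The product `*` on the symmetric algebra -/

/-- The derivation `x ▷ ·` is also a coderivation. -/
theorem comul_der (x : L) (A : SymmetricAlgebra ℝ L) :
    Coalgebra.comul (R := ℝ) (der x A) =
      LinearMap.rTensor _ (der x).toLinearMap (Coalgebra.comul (R := ℝ) A) +
        LinearMap.lTensor _ (der x).toLinearMap (Coalgebra.comul (R := ℝ) A) := by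
  -- The right-hand side, as an operator on the tensor square, is a derivation.
  have key : ∀ z w : SymmetricAlgebra ℝ L ⊗[ℝ] SymmetricAlgebra ℝ L,
      LinearMap.rTensor _ (der x).toLinearMap (z * w) +
        LinearMap.lTensor _ (der x).toLinearMap (z * w) =
      z * (LinearMap.rTensor _ (der x).toLinearMap w +
        LinearMap.lTensor _ (der x).toLinearMap w) +
      w * (LinearMap.rTensor _ (der x).toLinearMap z +
        LinearMap.lTensor _ (der x).toLinearMap z) := by
    intro z w
    induction z using TensorProduct.induction_on with
    | zero => simp
    | add z z' hz hz' =>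
      simp only [add_mul, map_add, mul_add] at hz hz' ⊢
      linear_combination hz + hz'
    | tmul a b =>
      induction w using TensorProduct.induction_on with
      | zero => simp
      | add w w' hw hw' =>
        simp only [add_mul, map_add, mul_add] at hw hw' ⊢
        linear_combination hw + hw'
      | tmul c d =>
        simp only [Algebra.TensorProduct.tmul_mul_tmul, LinearMap.rTensor_tmul,
          LinearMap.lTensor_tmul, Derivation.coeFn_coe, Derivation.leibniz, smul_eq_mul,
          TensorProduct.add_tmul, TensorProduct.tmul_add, mul_add, mul_comm c a, mul_comm d b]
        abel
  induction A using SymmetricAlgebra.induction with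
  | algebraMap r => simp [Algebra.TensorProduct.algebraMap_apply]
  | ι y => simp [der_ι]
  | add a b ha hb => simp only [map_add, ha, hb]; abel
  | mul a b ha hb =>
    rw [Derivation.leibniz, map_add, smul_eq_mul, smul_eq_mul, Bialgebra.comul_mul,
      Bialgebra.comul_mul, Bialgebra.comul_mul, ha, hb, key]

/-- The case of associativity of `*` in which the outer factors have degree one. -/
theorem star_star_ι (x y : L) (A : SymmetricAlgebra ℝ L) :
    star (star (ι ℝ L x) A) (ι ℝ L y) = star (ι ℝ L x) (star A (ι ℝ L y)) := by
  rw [star_ι, star_ι]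
  have hg : ∀ B, (graftHom (ι ℝ L y)).ofConv B = ι ℝ L (act B y) := fun B => graft_ι B y
  have key : ∀ z : SymmetricAlgebra ℝ L ⊗[ℝ] SymmetricAlgebra ℝ L,
      LinearMap.mul' ℝ _ (TensorProduct.map LinearMap.id (graftHom (ι ℝ L y)).ofConv
        ((ι ℝ L x ⊗ₜ[ℝ] 1 + 1 ⊗ₜ[ℝ] ι ℝ L x) * z +
          (LinearMap.rTensor _ (der x).toLinearMap z +
            LinearMap.lTensor _ (der x).toLinearMap z))) =
      ι ℝ L x * LinearMap.mul' ℝ _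
          (TensorProduct.map LinearMap.id (graftHom (ι ℝ L y)).ofConv z) +
        der x (LinearMap.mul' ℝ _
          (TensorProduct.map LinearMap.id (graftHom (ι ℝ L y)).ofConv z)) := by
    intro z
    induction z using TensorProduct.induction_on with
    | zero => simp
    | add z w hz hw =>
      simp only [mul_add, map_add] at hz hw ⊢
      linear_combination hz + hw
    | tmul a b =>
      simp only [add_mul, Algebra.TensorProduct.tmul_mul_tmul, LinearMap.rTensor_tmul,
        LinearMap.lTensor_tmul, Derivation.coeFn_coe, one_mul, map_add, TensorProduct.map_tmul,
        LinearMap.id_apply, LinearMap.mul'_apply, hg, act_ι_mul, map_sub, Derivation.leibniz,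
        der_ι, smul_eq_mul]
      ring
  have := key (Coalgebra.comul A)
  rwa [← comul_der, ← comul_ι, ← Bialgebra.comul_mul, ← map_add] at this

theorem star_one_left (B : SymmetricAlgebra ℝ L) : star 1 B = B := by
  have h1 : (graftHom B).ofConv 1 = B := graft_one_left B
  simp [star, Algebra.TensorProduct.one_def, h1]

/-- The powers `x * ⋯ * x` of `x ∈ L`, with the factors multiplied from the left. -/
def leftStarPow (x : L) : ℕ → SymmetricAlgebra ℝ L
  | 0 => 1
  | n + 1 => star (ι ℝ L x) (leftStarPow x n)

theorem star_leftStarPow_ι (x : L) (n : ℕ) :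
    star (leftStarPow x n) (ι ℝ L x) = leftStarPow x (n + 1) := by
  induction n with
  | zero => rw [leftStarPow, leftStarPow, leftStarPow, star_one_left, star_ι]; simp
  | succ n ih => rw [leftStarPow, star_star_ι, ih]; rfl

/-- The powers of `x` for `*` act by iterated multiplication by `x`, because
`(x * A) ▷ y = (x A) ▷ y + (x ▷ A) ▷ y = x ▷ (A ▷ y)`. -/
theorem act_leftStarPow (x y : L) (n : ℕ) :
    act (leftStarPow x n) y = (LinearMap.mulLeft ℝ x ^ n) y := by
  induction n with
  | zero => simp [leftStarPow, act_one]
  | succ n ih =>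
    rw [leftStarPow, star_ι, map_add, LinearMap.add_apply, act_ι_mul, sub_add_cancel, ih,
      pow_succ', Module.End.mul_apply, LinearMap.mulLeft_apply]

/-! ### The exponential series for the product `*` -/

theorem coeff_seriesGraft_stepTimes (f : L) (α : PowerSeries (SymmetricAlgebra ℝ L)) (n : ℕ) :
    PowerSeries.coeff (n + 1) (seriesGraft α (stepTimes f)) =
      ι ℝ L (act (PowerSeries.coeff n α) f) := by
  rw [seriesGraft, PowerSeries.coeff_mk, Finset.sum_eq_single (n, 1)]
  · rw [stepTimes, PowerSeries.coeff_monomial_same, graft_ι]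
  · rintro ⟨i, j⟩ hij hne
    rw [stepTimes, PowerSeries.coeff_monomial, if_neg]
    · simp [graft]
    · rintro rfl
      simp at hij hne
      exact hne hij
  · simp

theorem coeff_zero_seriesGraft_stepTimes (f : L) (α : PowerSeries (SymmetricAlgebra ℝ L)) :
    PowerSeries.coeff 0 (seriesGraft α (stepTimes f)) = 0 := by
  simp [seriesGraft, stepTimes, PowerSeries.coeff_monomial, graft]

/-- The powers in the exponential series are formed by multiplication from the right; by
`star_leftStarPow_ι` the order of the factors does not matter. -/
theorem starPow_stepTimes (f : L) (k : ℕ) :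
    starPow (stepTimes f) k = PowerSeries.monomial k (leftStarPow f k) := by
  induction k with
  | zero => simp [starPow, leftStarPow]
  | succ k ih =>
    rw [starPow, ih]
    ext1 n
    rw [seriesStar, PowerSeries.coeff_mk, PowerSeries.coeff_monomial]
    split_ifs with hn
    · subst hn
      rw [Finset.sum_eq_single (k, 1)]
      · rw [stepTimes, PowerSeries.coeff_monomial_same, PowerSeries.coeff_monomial_same,
          star_leftStarPow_ι]
      · rintro ⟨i, j⟩ hij hne
        rw [stepTimes, PowerSeries.coeff_monomial, PowerSeries.coeff_monomial]
        by_cases hi : i = k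
        · rw [if_neg (c := j = 1)]
          · simp [star]
          · rintro rfl
            exact hne (by rw [hi])
        · rw [if_neg hi]; simp [star]
      · simp
    · refine Finset.sum_eq_zero fun ij hij => ?_
      rw [stepTimes, PowerSeries.coeff_monomial, PowerSeries.coeff_monomial]
      by_cases hi : ij.1 = k
      · rw [if_neg (c := ij.2 = 1)]
        · simp [star]
        · intro hj
          rw [Finset.HasAntidiagonal.mem_antidiagonal, hi, hj] at hij
          exact hn hij.symm
      · rw [if_neg hi]; simp [star]

theorem coeff_expStar_stepTimes (f : L) (n : ℕ) :
    PowerSeries.coeff n (expStar (stepTimes f)) = ((n.factorial : ℝ)⁻¹) • leftStarPow f n := by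
  rw [expStar, PowerSeries.coeff_mk, Finset.sum_eq_single n]
  · rw [starPow_stepTimes, PowerSeries.coeff_monomial_same]
  · intro k _ hk
    rw [starPow_stepTimes, PowerSeries.coeff_monomial, if_neg hk.symm, smul_zero]
  · simp

/-! ### The exponential series for the symmetric product -/

theorem coeff_pow_eq_zero {α : PowerSeries (SymmetricAlgebra ℝ L)}
    (hα : PowerSeries.coeff 0 α = 0) {n k : ℕ} (h : n < k) :
    PowerSeries.coeff n (α ^ k) = 0 := by
  have : PowerSeries.X ^ k ∣ α ^ k :=
    pow_dvd_pow_of_dvd (PowerSeries.X_dvd_iff.2 (by simpa using hα)) k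
  exact PowerSeries.X_pow_dvd_iff.1 this n h

/-- The sum may be taken up to any `N ≥ n`, so that one polynomial expression in `α` serves for all
coefficients up to `N`. -/
theorem coeff_expSym {α : PowerSeries (SymmetricAlgebra ℝ L)}
    (hα : PowerSeries.coeff 0 α = 0) {n N : ℕ} (h : n ≤ N) :
    PowerSeries.coeff n (expSym α) =
      PowerSeries.coeff n (∑ k ∈ Finset.range (N + 1), ((k.factorial : ℝ)⁻¹) • α ^ k) := by
  rw [expSym, PowerSeries.coeff_mk, map_sum]
  simp only [PowerSeries.coeff_smul]
  refine Finset.sum_subset (Finset.range_mono (by omega)) fun k _ hk => ?_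
  rw [coeff_pow_eq_zero hα (by simpa using hk), smul_zero]

/-- The exponential preserves congruences modulo powers of `h`. -/
theorem X_pow_dvd_expSym_sub {α β : PowerSeries (SymmetricAlgebra ℝ L)} {n : ℕ}
    (h : PowerSeries.X ^ n ∣ α - β) : PowerSeries.X ^ n ∣ expSym α - expSym β := by
  rw [PowerSeries.X_pow_dvd_iff]
  intro m hm
  rw [map_sub, expSym, expSym, PowerSeries.coeff_mk, PowerSeries.coeff_mk,
    ← Finset.sum_sub_distrib]
  refine Finset.sum_eq_zero fun k _ => ?_
  rw [← smul_sub, ← map_sub,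
    PowerSeries.X_pow_dvd_iff.1 (h.trans (sub_dvd_pow_sub_pow α β k)) m hm, smul_zero]

theorem coeff_expSym_congr {α β : PowerSeries (SymmetricAlgebra ℝ L)} {n : ℕ}
    (h : PowerSeries.X ^ (n + 1) ∣ α - β) :
    PowerSeries.coeff n (expSym α) = PowerSeries.coeff n (expSym β) := by
  rw [← sub_eq_zero, ← map_sub]
  exact PowerSeries.X_pow_dvd_iff.1 (X_pow_dvd_expSym_sub h) n n.lt_succ_self

/-- The chain rule `δ (exp α) = exp(α) δ α`, for partial sums of the exponential series. -/
theorem derivation_exp_partialSum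
    (δ : Derivation ℝ (PowerSeries (SymmetricAlgebra ℝ L)) (PowerSeries (SymmetricAlgebra ℝ L)))
    (α : PowerSeries (SymmetricAlgebra ℝ L)) (N : ℕ) :
    δ (∑ k ∈ Finset.range (N + 1), ((k.factorial : ℝ)⁻¹) • α ^ k) =
      (∑ k ∈ Finset.range N, ((k.factorial : ℝ)⁻¹) • α ^ k) * δ α := by
  rw [Finset.sum_range_succ', map_add, map_sum, Finset.sum_mul]
  simp only [pow_zero, Derivation.map_smul, Derivation.map_one_eq_zero, smul_zero, add_zero]
  refine Finset.sum_congr rfl fun k _ => ?_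
  rw [Derivation.leibniz_pow, Nat.add_sub_cancel, smul_mul_assoc, ← Nat.cast_smul_eq_nsmul ℝ,
    smul_smul, Nat.factorial_succ, smul_eq_mul]
  congr 1
  have := Nat.factorial_ne_zero k
  push_cast
  field_simp

/-- The coefficientwise derivation `α ↦ x ▷ α` of the series. -/
def seriesDer (x : L) :
    Derivation ℝ (PowerSeries (SymmetricAlgebra ℝ L)) (PowerSeries (SymmetricAlgebra ℝ L)) :=
  Derivation.mk'
    { toFun := fun α => PowerSeries.mk fun n => der x (PowerSeries.coeff n α)
      map_add' := fun α β => by ext1 n; simp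
      map_smul' := fun r α => by ext1 n; simp }
    (fun α β => by
      ext1 n
      simp only [LinearMap.coe_mk, AddHom.coe_mk, PowerSeries.coeff_mk, PowerSeries.coeff_mul,
        map_add, map_sum, Derivation.leibniz, smul_eq_mul]
      rw [Finset.sum_add_distrib]
      congr 1
      rw [← Finset.Nat.sum_antidiagonal_swap]
      rfl)

theorem coeff_seriesDer (x : L) (α : PowerSeries (SymmetricAlgebra ℝ L)) (n : ℕ) :
    PowerSeries.coeff n (seriesDer x α) = der x (PowerSeries.coeff n α) := by
  simp [seriesDer]

/-- The series `∑ₙ hⁿ⁺¹ / (n+1)! ℓⁿ f`, where `ℓ` is the left multiplication by `f`: the logarithm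
of `exp*(h f)` for the symmetric product. -/
def flowLog (f : L) : PowerSeries (SymmetricAlgebra ℝ L) :=
  PowerSeries.mk fun n => n.casesOn 0 fun m =>
    (((m + 1).factorial : ℝ)⁻¹) • ι ℝ L ((LinearMap.mulLeft ℝ f ^ m) f)

theorem coeff_zero_flowLog (f : L) : PowerSeries.coeff 0 (flowLog f) = 0 := by
  rw [flowLog, PowerSeries.coeff_mk]
  rfl

theorem coeff_succ_flowLog (f : L) (n : ℕ) : PowerSeries.coeff (n + 1) (flowLog f) =
    (((n + 1).factorial : ℝ)⁻¹) • ι ℝ L ((LinearMap.mulLeft ℝ f ^ n) f) := by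
  rw [flowLog, PowerSeries.coeff_mk]

theorem succ_smul_factorial_inv {M : Type*} [AddCommGroup M] [Module ℝ M] (n : ℕ) (x : M) :
    ((n : ℝ) + 1) • (((n + 1).factorial : ℝ)⁻¹ • x) = (n.factorial : ℝ)⁻¹ • x := by
  rw [smul_smul, Nat.factorial_succ]
  congr 1
  have := Nat.factorial_ne_zero n
  push_cast
  field_simp

/-- `exp*(h f)` is the symmetric exponential of an element of `L[[h]]`: both sides solve
`y' = f y + f ▷ y`. -/
theorem expSym_flowLog (f : L) : expSym (flowLog f) = expStar (stepTimes f) := by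
  have hz := coeff_zero_flowLog f
  -- For the derivation `δ = d/dh - f ▷ ·`, the equation says `δ y = f y`, and `δ W = f`.
  let δ := (PowerSeries.derivative (SymmetricAlgebra ℝ L)).restrictScalars ℝ - seriesDer f
  have hδ : ∀ α n, PowerSeries.coeff n (δ α) =
      ((n : ℝ) + 1) • PowerSeries.coeff (n + 1) α - der f (PowerSeries.coeff n α) := by
    intro α n
    change PowerSeries.coeff n (PowerSeries.derivative _ α - seriesDer f α) = _
    rw [map_sub, coeff_seriesDer, PowerSeries.coeff_derivative]
    congr 1
    rw [Algebra.smul_def]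
    simp [mul_comm]
  have hδW : δ (flowLog f) = PowerSeries.C (ι ℝ L f) := by
    ext1 n
    rw [hδ, PowerSeries.coeff_C, coeff_succ_flowLog, succ_smul_factorial_inv]
    cases n with
    | zero => simp [hz]
    | succ n =>
      rw [coeff_succ_flowLog, Derivation.map_smul, der_ι, if_neg n.succ_ne_zero, pow_succ',
        Module.End.mul_apply, LinearMap.mulLeft_apply, sub_self]
  ext1 n
  rw [coeff_expStar_stepTimes]
  induction n with
  | zero => simp [expSym, leftStarPow]
  | succ n ih =>
    have h := congrArg (PowerSeries.coeff n) (derivation_exp_partialSum δ (flowLog f) (n + 1))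
    rw [hδ, hδW, PowerSeries.coeff_mul_C, ← coeff_expSym hz le_rfl, ← coeff_expSym hz n.le_succ,
      ← coeff_expSym hz le_rfl, ih, sub_eq_iff_eq_add] at h
    have hne : ((n : ℝ) + 1) ≠ 0 := by positivity
    apply smul_right_injective _ hne
    dsimp only
    rw [h, succ_smul_factorial_inv, leftStarPow, star_ι, Derivation.map_smul, smul_add,
      smul_mul_assoc, mul_comm]

/-- `flowLog f` solves `h y' = exp(y) ▷ (h f)`. -/
theorem coeff_succ_flowLog_eq_act (f : L) (n : ℕ) :
    ((n : ℝ) + 1) • PowerSeries.coeff (n + 1) (flowLog f) =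
      ι ℝ L (act (PowerSeries.coeff n (expSym (flowLog f))) f) := by
  rw [expSym_flowLog, coeff_expStar_stepTimes, coeff_succ_flowLog, succ_smul_factorial_inv,
    map_smul, LinearMap.smul_apply, act_leftStarPow, map_smul]

/-- The equation `h y' = exp(y) ▷ (h f)` determines a series without constant term. -/
theorem eq_flowLog {f : L} {W : PowerSeries (SymmetricAlgebra ℝ L)}
    (h0 : PowerSeries.coeff 0 W = 0)
    (h : ∀ n : ℕ, ((n : ℝ) + 1) • PowerSeries.coeff (n + 1) W =
      ι ℝ L (act (PowerSeries.coeff n (expSym W)) f)) : W = flowLog f := by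
  ext1 n
  induction n using Nat.strong_induction_on with
  | _ n ih =>
    cases n with
    | zero => rw [h0, coeff_zero_flowLog]
    | succ n =>
      have hne : ((n : ℝ) + 1) ≠ 0 := by positivity
      apply smul_right_injective _ hne
      dsimp only
      rw [h, coeff_succ_flowLog_eq_act, coeff_expSym_congr]
      rw [PowerSeries.X_pow_dvd_iff]
      intro m hm
      rw [map_sub, ih m hm, sub_self]

/-- The coefficient of `hⁿ⁺¹` in the stages is determined by the coefficients up to `hⁿ`. -/
theorem IsStages.unique {s : ℕ} {A : Matrix (Fin s) (Fin s) ℝ} {f : L}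
    {K K' : Fin s → PowerSeries (SymmetricAlgebra ℝ L)}
    (h : IsStages A f K) (h' : IsStages A f K') : K' = K := by
  suffices H : ∀ n i, PowerSeries.coeff n (K' i) = PowerSeries.coeff n (K i) by
    funext i
    ext1 n
    exact H n i
  intro n
  induction n using Nat.strong_induction_on with
  | _ n ih =>
    intro i
    cases n with
    | zero => rw [(h.1 i).1, (h'.1 i).1]
    | succ n =>
      rw [h.2 i, h'.2 i, coeff_seriesGraft_stepTimes, coeff_seriesGraft_stepTimes,
        coeff_expSym_congr]
      rw [PowerSeries.X_pow_dvd_iff]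
      intro m hm
      rw [map_sub, map_sum, map_sum, sub_eq_zero]
      exact Finset.sum_congr rfl fun j _ => by
        rw [PowerSeries.coeff_smul, PowerSeries.coeff_smul, ih m hm]

end

end PreLie

namespace PreLie

open SymmetricAlgebra
open BSeries (Tree Forest Series)

noncomputable section

variable {L : Type*} [LeftPreLieRing L] [LeftPreLieAlgebra ℝ L]

/-! ### Elementary differentials -/

/-- The elementary differential of `f` at a tree: `F(B⁺(τ₁ ⋯ τ_k)) = (F(τ₁) ⋯ F(τ_k)) ▷ f`. -/
def elementaryDifferential (f : L) (τ : Tree) : L :=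
  act ((Tree.Bminus τ).attach.map fun c => ι ℝ L (elementaryDifferential f c.1)).prod f
termination_by τ.order
decreasing_by exact Tree.order_lt_of_mem c.2

/-- The product in `S(L)` of the elementary differentials at the trees of a forest. -/
def forestDifferential (f : L) (ω : Forest) : SymmetricAlgebra ℝ L :=
  (ω.map fun τ => ι ℝ L (elementaryDifferential f τ)).prod

theorem elementaryDifferential_Bplus (f : L) (ω : Forest) :
    elementaryDifferential f (Tree.Bplus ω) = act (forestDifferential f ω) f := by
  rw [elementaryDifferential,
    Multiset.attach_map_val' _ fun τ => ι ℝ L (elementaryDifferential f τ),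
    Tree.Bminus_Bplus, forestDifferential]

/-- The value `h^{|τ|} F(τ)` at the tree `τ` of the substitution of `f` into a B-series. -/
def treeTerm (f : L) (τ : Tree) : PowerSeries (SymmetricAlgebra ℝ L) :=
  PowerSeries.monomial τ.order (ι ℝ L (elementaryDifferential f τ))

theorem hasSubst_treeTerm (f : L) : MvPowerSeries.HasSubst (treeTerm f) where
  const_coeff τ := by
    have : PowerSeries.constantCoeff (treeTerm f τ) = 0 := by
      rw [← PowerSeries.coeff_zero_eq_constantCoeff_apply, treeTerm,
        PowerSeries.coeff_monomial, if_neg τ.order_pos.ne]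
    change IsNilpotent (PowerSeries.constantCoeff (treeTerm f τ))
    rw [this]
    exact IsNilpotent.zero
  coeff_zero d := by
    refine (Tree.finite_order_le (d ())).subset fun τ hτ => ?_
    by_contra hne
    refine hτ ?_
    have : PowerSeries.coeff (d ()) (treeTerm f τ) = 0 := by
      rw [treeTerm, PowerSeries.coeff_monomial, if_neg]
      rintro h
      exact hne h.ge
    rw [PowerSeries.coeff_def rfl] at this
    convert this

/-- The substitution of `f` into B-series: the algebra morphism that maps the tree `τ` to
`h^{|τ|} F(τ)`. -/
def substitute (f : L) : Series →ₐ[ℝ] PowerSeries (SymmetricAlgebra ℝ L) :=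
  MvPowerSeries.substAlgHom (hasSubst_treeTerm f)

theorem finite_forest_order_eq (n : ℕ) : {ω : Forest | Forest.order ω = n}.Finite := by
  refine Set.Finite.subset
    ((Tree.finite_order_le (1 + n)).preimage Tree.Bplus_injective.injOn) fun ω hω => ?_
  rw [Set.mem_preimage, Set.mem_ofPred_eq, Tree.order_Bplus]
  exact Nat.add_le_add_left (le_of_eq hω) 1

/-- The forests with `n` vertices. -/
def forestsOfOrder (n : ℕ) : Finset Forest := (finite_forest_order_eq n).toFinset

theorem mem_forestsOfOrder {n : ℕ} {ω : Forest} :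
    ω ∈ forestsOfOrder n ↔ Forest.order ω = n := by
  simp [forestsOfOrder]

open scoped Classical in
theorem prod_treeTerm (f : L) (ω : Forest) :
    ((Multiset.toFinsupp ω).prod fun τ n => treeTerm f τ ^ n) =
      PowerSeries.monomial (Forest.order ω) (forestDifferential f ω) := by
  rw [Finsupp.prod, Multiset.toFinsupp_support]
  simp only [Multiset.toFinsupp_apply]
  rw [← Finset.prod_multiset_map_count]
  induction ω using Multiset.induction_on with
  | empty => simp [Forest.order, forestDifferential]
  | cons τ ω ih =>
    rw [Multiset.map_cons, Multiset.prod_cons, ih, treeTerm, PowerSeries.monomial_mul_monomial]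
    simp [Forest.order, forestDifferential]

theorem coeff_substitute (f : L) (α : Series) (n : ℕ) :
    PowerSeries.coeff n (substitute f α) =
      ∑ ω ∈ forestsOfOrder n, BSeries.coeff ω α • forestDifferential f ω := by
  classical
  rw [substitute, MvPowerSeries.substAlgHom_apply, PowerSeries.coeff,
    MvPowerSeries.coeff_subst (hasSubst_treeTerm f),
    ← finsum_comp_equiv Multiset.toFinsupp.toEquiv]
  have e : ∀ ω : Forest, MvPowerSeries.coeff (Multiset.toFinsupp ω) α •
      MvPowerSeries.coeff (Finsupp.single () n)
        ((Multiset.toFinsupp ω).prod fun τ n => treeTerm f τ ^ n) =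
      if Forest.order ω = n then BSeries.coeff ω α • forestDifferential f ω else 0 := by
    intro ω
    have h := prod_treeTerm f ω
    change MvPowerSeries.coeff (Multiset.toFinsupp ω) α • PowerSeries.coeff n _ = _
    rw [h, PowerSeries.coeff_monomial]
    by_cases hn : Forest.order ω = n
    · rw [if_pos hn, if_pos hn.symm, BSeries.coeff]
    · rw [if_neg hn, if_neg (Ne.symm hn), smul_zero]
  refine (finsum_congr e).trans ?_
  rw [finsum_eq_sum_of_support_subset (s := forestsOfOrder n)]
  · exact Finset.sum_congr rfl fun ω hω => if_pos (mem_forestsOfOrder.1 hω)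
  · intro ω hω
    by_contra hn
    exact hω (if_neg fun h => hn (mem_forestsOfOrder.2 h))

theorem coeff_substitute_congr (f : L) {α β : Series} {n : ℕ}
    (h : ∀ ω, Forest.order ω = n → BSeries.coeff ω α = BSeries.coeff ω β) :
    PowerSeries.coeff n (substitute f α) = PowerSeries.coeff n (substitute f β) := by
  rw [coeff_substitute, coeff_substitute]
  exact Finset.sum_congr rfl fun ω hω => by rw [h ω (mem_forestsOfOrder.1 hω)]

theorem coeff_zero_substitute (f : L) {α : Series}
    (h : BSeries.IsInfinitesimalCharacter α) :
    PowerSeries.coeff 0 (substitute f α) = 0 := by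
  rw [coeff_substitute]
  refine Finset.sum_eq_zero fun ω hω => ?_
  have h0 : ω = 0 := Multiset.card_eq_zero.1 (Nat.eq_zero_of_le_zero
    ((Forest.card_le_order ω).trans (mem_forestsOfOrder.1 hω).le))
  rw [h0, h.coeff_eq_zero (by simp), zero_smul]

/-- Only powers with exponent at most the degree of a forest contribute to its coefficient in an
exponential, and that degree is at most the number of vertices. -/
theorem substitute_exp (f : L) {α : Series} (h : BSeries.IsInfinitesimalCharacter α) :
    substitute f (BSeries.exp α) = expSym (substitute f α) := by
  classical
  ext1 n
  rw [coeff_expSym (coeff_zero_substitute f h) le_rfl]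
  simp_rw [← map_pow, ← map_smul]
  rw [← map_sum]
  refine coeff_substitute_congr f fun ω hω => ?_
  rw [BSeries.coeff, BSeries.coeff]
  change BSeries.exp α _ = _
  rw [BSeries.exp, map_sum]
  simp only [MvPowerSeries.coeff_smul]
  have hd : (Multiset.toFinsupp ω).degree ≤ n := by
    rw [← hω]
    refine le_trans (le_of_eq ?_) (Forest.card_le_order ω)
    exact Multiset.toFinsupp_sum_eq ω
  refine Finset.sum_subset (Finset.range_mono (by omega)) fun k _ hk => ?_
  rw [BSeries.coeff_pow_of_isInfinitesimalCharacter h, if_neg, mul_zero]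
  rintro rfl
  simp at hk

/-- A forest whose coefficient in `α ▷ •` is nonzero is a tree, and substitution turns `B⁺` into
the action on `f`. -/
theorem coeff_succ_substitute_graftBullet (f : L) (β : Series) (n : ℕ) :
    PowerSeries.coeff (n + 1) (substitute f (BSeries.graftBullet β)) =
      ι ℝ L (act (PowerSeries.coeff n (substitute f β)) f) := by
  rw [coeff_substitute, coeff_substitute, map_sum, LinearMap.sum_apply, map_sum]
  symm
  refine Finset.sum_of_injOn (fun ω => {Tree.Bplus ω}) ?_ ?_ ?_ ?_
  · exact fun ω _ ω' _ h => Tree.Bplus_injective (Multiset.singleton_inj.1 h)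
  · intro ω hω
    rw [Finset.mem_coe, mem_forestsOfOrder] at hω ⊢
    rw [Forest.order, Multiset.map_singleton, Multiset.sum_singleton, Tree.order_Bplus, add_comm]
    exact congrArg (· + 1) hω
  · intro ω hω hn
    rw [(BSeries.isInfinitesimalCharacter_graftBullet β).coeff_eq_zero, zero_smul]
    intro hc
    obtain ⟨τ, rfl⟩ := Multiset.card_eq_one.1 hc
    refine hn ⟨Tree.Bminus τ, ?_, by dsimp only; rw [Tree.Bplus_Bminus]⟩
    rw [mem_forestsOfOrder, Forest.order, Multiset.map_singleton, Multiset.sum_singleton,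
      ← Tree.Bplus_Bminus τ, Tree.order_Bplus] at hω
    rw [Finset.mem_coe, mem_forestsOfOrder, Forest.order]
    omega
  · intro ω _
    rw [BSeries.coeff_graftBullet, map_smul, LinearMap.smul_apply, map_smul,
      forestDifferential.eq_1 f {_}, Multiset.map_singleton, Multiset.prod_singleton,
      elementaryDifferential_Bplus]

theorem substitute_graftBullet (f : L) (β : Series) :
    substitute f (BSeries.graftBullet β) = seriesGraft (substitute f β) (stepTimes f) := by
  ext1 n
  cases n with
  | zero =>
    rw [coeff_zero_substitute f (BSeries.isInfinitesimalCharacter_graftBullet β),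
      coeff_zero_seriesGraft_stepTimes]
  | succ n => rw [coeff_succ_substitute_graftBullet, coeff_seriesGraft_stepTimes]

/-! ### The Runge–Kutta method and the exact flow as images of B-series -/

theorem isStages_substitute {s : ℕ} {A : Matrix (Fin s) (Fin s) ℝ} {K : Fin s → Series}
    (h : BSeries.IsStages A K) (f : L) : IsStages A f fun i => substitute f (K i) := by
  have e : ∀ i, substitute f (K i) =
      seriesGraft (expSym (∑ j, A i j • substitute f (K j))) (stepTimes f) := by
    intro i
    conv_lhs => rw [h.2 i, substitute_graftBullet,
      substitute_exp f (BSeries.isInfinitesimalCharacter_sum h.1 _)]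
    simp only [map_sum, map_smul]
  refine ⟨fun i => ⟨coeff_zero_substitute f (h.1 i), fun n => ?_⟩, e⟩
  cases n with
  | zero => rw [coeff_zero_substitute f (h.1 i)]; exact zero_mem _
  | succ n => dsimp only; rw [e i, coeff_seriesGraft_stepTimes]; exact ⟨_, rfl⟩

theorem rkResult_substitute {s : ℕ} (b : Fin s → ℝ) {K : Fin s → Series}
    (h : ∀ i, BSeries.IsInfinitesimalCharacter (K i)) (f : L) :
    rkResult b (fun i => substitute f (K i)) = substitute f (BSeries.rkCharacter b K) := by
  rw [rkResult, BSeries.rkCharacter, substitute_exp f (BSeries.isInfinitesimalCharacter_sum h b)]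
  simp only [map_sum, map_smul]

end

end PreLie

namespace BSeries

noncomputable section

/-- The infinitesimal character `τ ↦ 1 / τ!`. -/
def exactFlow : Series := ofTree fun τ => 1 / (τ.factorial : ℝ)

theorem isInfinitesimalCharacter_exactFlow : IsInfinitesimalCharacter exactFlow :=
  isInfinitesimalCharacter_ofTree _

/-- The recursion of the tree factorial, as the equation `h y' = exp(y) ▷ •` for B-series. -/
theorem order_mul_coeff_exactFlow (ω : Forest) :
    (Forest.order ω : ℝ) * coeff ω exactFlow = coeff ω (graftBullet (exp exactFlow)) := by
  by_cases hc : ω.card = 1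
  · obtain ⟨τ, rfl⟩ := Multiset.card_eq_one.1 hc
    obtain ⟨η, rfl⟩ : ∃ η, Tree.Bplus η = τ := ⟨_, Tree.Bplus_Bminus τ⟩
    rw [coeff_eq_pairing_div, coeff_eq_pairing_div, pairing_graftBullet,
      pairing_exp isInfinitesimalCharacter_exactFlow, exactFlow, ← mul_div_assoc]
    simp only [pairing_ofTree, Forest.order, Multiset.map_singleton, Multiset.sum_singleton]
    rw [Tree.factorial_Bplus]
    have h : ((Tree.Bplus η).order : ℝ) ≠ 0 := by exact_mod_cast (Tree.order_pos _).ne'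
    have e : (η.map fun τ => 1 / (τ.factorial : ℝ)).prod =
        ((η.map Tree.factorial).prod : ℝ)⁻¹ := by
      rw [Nat.cast_multiset_prod, ← Multiset.prod_map_inv, Multiset.map_map]
      simp only [one_div, Function.comp_def]
    rw [e]
    push_cast
    field_simp
  · rw [isInfinitesimalCharacter_exactFlow.coeff_eq_zero hc,
      (isInfinitesimalCharacter_graftBullet _).coeff_eq_zero hc, mul_zero]

end

end BSeries

namespace PreLie

variable {L : Type*} [LeftPreLieRing L] [LeftPreLieAlgebra ℝ L]

theorem substitute_exactFlow (f : L) : substitute f BSeries.exactFlow = flowLog f := by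
  have h := BSeries.isInfinitesimalCharacter_exactFlow
  refine eq_flowLog (coeff_zero_substitute f h) fun n => ?_
  rw [← substitute_exp f h, ← coeff_succ_substitute_graftBullet, coeff_substitute,
    coeff_substitute, Finset.smul_sum]
  refine Finset.sum_congr rfl fun ω hω => ?_
  rw [← BSeries.order_mul_coeff_exactFlow, mem_forestsOfOrder.1 hω, smul_smul]
  push_cast
  rfl

/-- The exact flow `exp*(h f)` is the image of the character with values `1 / τ!` on trees. -/
theorem expStar_stepTimes_eq_substitute (f : L) :
    expStar (stepTimes f) = substitute f (BSeries.exp BSeries.exactFlow) := by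
  rw [substitute_exp f BSeries.isInfinitesimalCharacter_exactFlow, substitute_exactFlow,
    expSym_flowLog]

/-- Characters are determined on a forest by their values on its trees, so agreement of two of
them on the trees with at most `p` vertices gives agreement modulo `h^{p+1}` in `L`. -/
theorem hasOrder_of_pairing_eq {s : ℕ} {A : Matrix (Fin s) (Fin s) ℝ} {b : Fin s → ℝ}
    {K : Fin s → BSeries.Series} (hK : BSeries.IsStages A K) {p : ℕ}
    (hp : ∀ τ : BSeries.Tree, τ.order ≤ p →
      BSeries.pairing (BSeries.rkCharacter b K) {τ} = 1 / (τ.factorial : ℝ)) :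
    HasOrder L A b p := by
  intro f
  have hs := isStages_substitute hK f
  refine ⟨_, hs, fun K' hK' => hs.unique hK', ?_⟩
  rw [rkResult_substitute b hK.1, expStar_stepTimes_eq_substitute, PowerSeries.X_pow_dvd_iff]
  intro n hn
  rw [map_sub, sub_eq_zero]
  refine coeff_substitute_congr f fun ω hω => ?_
  have hb := BSeries.isInfinitesimalCharacter_sum hK.1 b
  rw [BSeries.coeff_eq_pairing_div, BSeries.coeff_eq_pairing_div, BSeries.rkCharacter,
    BSeries.pairing_exp hb, BSeries.pairing_exp BSeries.isInfinitesimalCharacter_exactFlow]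
  congr 2
  refine Multiset.map_congr rfl fun τ hτ => ?_
  have := hp τ (by have := BSeries.Forest.order_le_of_mem hτ; omega)
  rw [BSeries.rkCharacter, BSeries.pairing_exp_singleton hb] at this
  rw [this, BSeries.exactFlow, BSeries.pairing_ofTree]

end PreLie

theorem mainTheorem3 (s : ℕ) (A : Matrix (Fin s) (Fin s) ℝ) (b : Fin s → ℝ) :
    ∃ K : Fin s → BSeries.Series,
      BSeries.IsStages A K ∧ (∀ K', BSeries.IsStages A K' → K' = K) ∧
      (∀ τ : BSeries.Tree,
        BSeries.pairing (BSeries.rkCharacter b K) {τ} = b ⬝ᵥ BSeries.stagePairing K τ) ∧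
      BSeries.stagePairing K BSeries.Tree.bullet = 1 ∧
      (∀ ω : BSeries.Forest, ω ≠ 0 →
        BSeries.stagePairing K (BSeries.Tree.Bplus ω) =
          (ω.map fun τ => A.mulVec (BSeries.stagePairing K τ)).prod) ∧
      ∀ p : ℕ,
        (∀ τ : BSeries.Tree, τ.order ≤ p →
          BSeries.pairing (BSeries.rkCharacter b K) {τ} = 1 / (τ.factorial : ℝ)) →
        ∀ (L : Type*) [LeftPreLieRing L] [LeftPreLieAlgebra ℝ L], PreLie.HasOrder L A b p := by
  obtain ⟨K, hK⟩ := BSeries.exists_isStages A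
  refine ⟨K, hK, fun K' hK' => hK.unique hK', fun τ => ?_, ?_,
    fun ω _ => BSeries.stagePairing_Bplus hK ω, fun p hp L _ _ =>
      PreLie.hasOrder_of_pairing_eq hK hp⟩
  · rw [BSeries.rkCharacter,
      BSeries.pairing_exp_singleton (BSeries.isInfinitesimalCharacter_sum hK.1 b),
      BSeries.pairing_sum]
    rfl
  · rw [BSeries.Tree.bullet, BSeries.stagePairing_Bplus hK, Multiset.map_zero,
      Multiset.prod_zero]
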